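/- Let $X,Y\subset\mathbb R^n$ be bounded and open with $X\neq\emptyset$, let $Z\subset\mathbb R$ be a nonempty open interval (possibly unbounded), let $b\in C^4(\mathrm{cl}(X\times Y))$ and $a\in C^2(\mathrm{cl}(Y))$, and put $G(x,y,z)=b(x,y)-z$ and $\pi(x,y,z)=z-a(y)$. Assume: (bi-twist) for all $x_0\in X$ and $y_0\in Y$, the maps $y\in \mathrm{cl}(Y)\mapsto D_xb(x_0,y)$ and $x\in \mathrm{cl}(X)\mapsto D_yb(x,y_0)$ are diffeomorphisms onto their ranges; (bi-convexity) for all $x_0\in X$ and $y_0\in Y$, the sets $D_xb(x_0,Y)$ and $D_yb(X,y_0)$ are convex; (non-negative cross-curvature) $\frac{\partial^4}{\partial s^2\partial t^2}\big|_{(s,t)=(0,0)}b(x(s),y(t))\ge 0$ for all $C^2$ curves $x:[-1,1]\to X$ and $y:[-1,1]\to Y$ such that $s\mapsto D_yb(x(s),y(0))$ or $t\mapsto D_xb(x(0),y(t))$ is an affinely parametrized line segment; (convex ranges) for each $x\in X$ the set $\{(D_xb(x,y),\,b(x,y)-z) : (y,z)\in \mathrm{cl}(Y\times Z)\}\subset\mathbb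 R^{n+1}$ is convex (this follows from bi-twist and bi-convexity if $Z=\mathbb R$). A function $u:X\to\mathbb R$ is $G$-convex if it is continuous and for each $x_0\in X$ there are $y_0\in \mathrm{cl}(Y)$ and $z_0\in \mathrm{cl}(Z)$ with $u(x_0)=G(x_0,y_0,z_0)$ and $u(x)\ge G(x,y_0,z_0)$ for all $x\in X$; let $\mathcal U$ be the set of $G$-convex functions. For a Borel probability measure $\mu$ on $X$ that is absolutely continuous with respect to Lebesgue measure, and $u\in\mathcal U$, let $$\mathbf\Pi(u)=\int_X \pi\big(x,\bar y_G(x,u(x),Du(x))\big)\,d\mu(x),$$ where $\bar y_G(x,u(x),Du(x))$ is the unique $(y,z)\in \mathrm{cl}(Y\times Z)$ with $G(x,y,z)=u(x)$ and $D_xG(x,y,z)=Du(x)$, which is defined for almost every $x\in X$. Call $a$ $b^*$-convex if $a=(a^b)^{b^*}$ on $\mathrm{cl}(Y)$, where $v^b(x)=\sup_{y\in \mathrm{cl}(Y)}\big(b(x,y)-v(y)\big)$ and $u^{b^*}(y)=\sup_{x\in \mathrm{cl}(X)}\big(b(x,y)-u(x)\big)$. Then $a$ is $b^*$-convex if and only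 if both of the following hold: (1) $\mathcal U$ is convex and $\mathbf\Pi$ is concave on $\mathcal U$, for every Borel probability measure $\mu\ll\mathcal L^n$ on $X$; (2) for every $y\in Y$ there exists $x\in \mathrm{cl}(X)$ such that $Da(y)=D_yb(x,y)$. -/

import Mathlib

open MeasureTheory Set

/-- `ℝⁿ` with its Euclidean structure. -/
abbrev Eucl (n : ℕ) : Type := EuclideanSpace ℝ (Fin n)

/-! ### The principal-agent framework for a general direct utility `G(x, y, z)` -/

section General

/-- `u` is `G`-convex on `X`: it is continuous there and, at every `x₀ ∈ X`, it is supported from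
below by some `G(·, y₀, z₀)` with `(y₀, z₀) ∈ cl(Y) × cl(Z)`. Only the values of `u` on `X` matter. -/
def IsGConvex {m n : ℕ} (G : Eucl m → Eucl n → ℝ → ℝ) (X : Set (Eucl m)) (Y : Set (Eucl n))
    (Z : Set ℝ) (u : Eucl m → ℝ) : Prop :=
  ContinuousOn u X ∧
    ∀ x₀ ∈ X, ∃ y₀ ∈ closure Y, ∃ z₀ ∈ closure Z,
      u x₀ = G x₀ y₀ z₀ ∧ ∀ x ∈ X, G x y₀ z₀ ≤ u x

/-- The set `𝒰` of all `G`-convex functions. -/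
def gConvexFunctions {m n : ℕ} (G : Eucl m → Eucl n → ℝ → ℝ) (X : Set (Eucl m)) (Y : Set (Eucl n))
    (Z : Set ℝ) : Set (Eucl m → ℝ) :=
  {u | IsGConvex G X Y Z u}

/-- Convexity of the range of `(y, z) ∈ cl(Y × Z) ↦ (G_x, G)(x, y, z)`, for each `x ∈ X`. -/
def HasConvexRanges {m n : ℕ} (G : Eucl m → Eucl n → ℝ → ℝ) (X : Set (Eucl m)) (Y : Set (Eucl n))
    (Z : Set ℝ) : Prop :=
  ∀ x ∈ X, Convex ℝ
    ((fun q : Eucl n × ℝ => (gradient (fun x' => G x' q.1 q.2) x, G x q.1 q.2)) ''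
      closure (Y ×ˢ Z))

/-- `ȳ_G(x, u, p)`: the solution `(y, z) ∈ cl(Y × Z)` of `G(x, y, z) = u`, `D_x G(x, y, z) = p`
(an arbitrary value if there is none). -/
noncomputable def optimalChoice {m n : ℕ} (G : Eucl m → Eucl n → ℝ → ℝ) (Y : Set (Eucl n))
    (Z : Set ℝ) (x : Eucl m) (u : ℝ) (p : Eucl m) : Eucl n × ℝ :=
  Classical.epsilon fun q : Eucl n × ℝ =>
    q ∈ closure (Y ×ˢ Z) ∧ G x q.1 q.2 = u ∧ gradient (fun x' => G x' q.1 q.2) x = p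

/-- The principal's profit `𝚷(u) = ∫_X π(x, ȳ_G(x, u(x), Du(x))) dμ(x)`. -/
noncomputable def principalProfit {m n : ℕ} (G π : Eucl m → Eucl n → ℝ → ℝ) (X : Set (Eucl m))
    (Y : Set (Eucl n)) (Z : Set ℝ) (μ : Measure (Eucl m)) (u : Eucl m → ℝ) : ℝ :=
  ∫ x in X, π x (optimalChoice G Y Z x (u x) (gradient u x)).1
    (optimalChoice G Y Z x (u x) (gradient u x)).2 ∂μ

/-- `𝚷` is concave on the (convex) set `𝒰`, for every Borel probability measure `μ` on `X` that is
absolutely continuous with respect to Lebesgue measure. -/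
def ProfitIsConcave {m n : ℕ} (G π : Eucl m → Eucl n → ℝ → ℝ) (X : Set (Eucl m))
    (Y : Set (Eucl n)) (Z : Set ℝ) : Prop :=
  ∀ μ : Measure (Eucl m), IsProbabilityMeasure μ → μ Xᶜ = 0 → μ ≪ volume →
    ConcaveOn ℝ (gConvexFunctions G X Y Z) (principalProfit G π X Y Z μ)

end General

/-! ### The quasilinear setting, with equal dimensions -/

section Quasilinear

/-- `f` maps `S` diffeomorphically onto its range `f(S)`. -/
def IsDiffeoOntoRange {n : ℕ} (f : Eucl n → Eucl n) (S : Set (Eucl n)) : Prop :=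
  ContDiffOn ℝ 1 f S ∧ ∃ g : Eucl n → Eucl n, ContDiffOn ℝ 1 g (f '' S) ∧ LeftInvOn g f S

/-- `D_x b(x, y)`. -/
noncomputable def gradX {n : ℕ} (b : Eucl n → Eucl n → ℝ) (x y : Eucl n) : Eucl n :=
  gradient (fun x' => b x' y) x

/-- `D_y b(x, y)`. -/
noncomputable def gradY {n : ℕ} (b : Eucl n → Eucl n → ℝ) (x y : Eucl n) : Eucl n :=
  gradient (fun y' => b x y') y

/-- Bi-twist. -/
def BiTwist {n : ℕ} (b : Eucl n → Eucl n → ℝ) (X Y : Set (Eucl n)) : Prop :=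
  (∀ x₀ ∈ X, IsDiffeoOntoRange (fun y => gradX b x₀ y) (closure Y)) ∧
    ∀ y₀ ∈ Y, IsDiffeoOntoRange (fun x => gradY b x y₀) (closure X)

/-- Bi-convexity of the domains. -/
def BiConvexDomains {n : ℕ} (b : Eucl n → Eucl n → ℝ) (X Y : Set (Eucl n)) : Prop :=
  (∀ x₀ ∈ X, Convex ℝ ((fun y => gradX b x₀ y) '' Y)) ∧
    ∀ y₀ ∈ Y, Convex ℝ ((fun x => gradY b x y₀) '' X)

/-- `c` is affinely parametrized on `[-1, 1]`. -/
def IsAffinelyParametrized {n : ℕ} (c : ℝ → Eucl n) : Prop :=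
  ∃ p q : Eucl n, ∀ s ∈ Icc (-1 : ℝ) 1, c s = p + s • q

/-- Non-negative cross-curvature: `∂⁴/∂s²∂t² b(x(s), y(t)) ≥ 0` at `(0, 0)` whenever one of the
curves `s ↦ D_y b(x(s), y(0))`, `t ↦ D_x b(x(0), y(t))` is an affinely parametrized segment. -/
def NonnegCrossCurvature {n : ℕ} (b : Eucl n → Eucl n → ℝ) (X Y : Set (Eucl n)) : Prop :=
  ∀ x y : ℝ → Eucl n,
    ContDiffOn ℝ 2 x (Icc (-1) 1) → ContDiffOn ℝ 2 y (Icc (-1) 1) →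
    MapsTo x (Icc (-1) 1) X → MapsTo y (Icc (-1) 1) Y →
    (IsAffinelyParametrized (fun s => gradY b (x s) (y 0)) ∨
      IsAffinelyParametrized (fun t => gradX b (x 0) (y t))) →
    0 ≤ iteratedDeriv 2 (fun s => iteratedDeriv 2 (fun t => b (x s) (y t)) 0) 0

/-- The `b`-transform `v^b(x) = sup_{y ∈ cl(Y)} b(x, y) - v(y)`. -/
noncomputable def bTransform {n : ℕ} (b : Eucl n → Eucl n → ℝ) (Y : Set (Eucl n))
    (v : Eucl n → ℝ) (x : Eucl n) : ℝ :=
  sSup ((fun y => b x y - v y) '' closure Y)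

/-- The `b*`-transform `u^{b*}(y) = sup_{x ∈ cl(X)} b(x, y) - u(x)`. -/
noncomputable def bStarTransform {n : ℕ} (b : Eucl n → Eucl n → ℝ) (X : Set (Eucl n))
    (u : Eucl n → ℝ) (y : Eucl n) : ℝ :=
  sSup ((fun x => b x y - u x) '' closure X)

/-- `a : cl(Y) → ℝ` is `b*`-convex: `a = (a^b)^{b*}` on `cl(Y)`. -/
def IsBStarConvex {n : ℕ} (b : Eucl n → Eucl n → ℝ) (X Y : Set (Eucl n)) (a : Eucl n → ℝ) : Prop :=
  EqOn a (bStarTransform b X (bTransform b Y a)) (closure Y)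

end Quasilinear

/-! Both sides of the equivalence pass through one intermediate property: for every `x₀ ∈ X`, `a -
b(x₀, ·)` is convex along the `b`-segments with respect to `x₀`, the curves in `cl(Y)` on which `D_x
b(x₀, ·)` is affine (`IsConvexAlongSegments`).

Curvature enters only through the fact that `b(x₁, ·)` has this property for every `x₁ ∈ cl(X)`.
Along a segment `y(t)` put `Q(x) = d²/dt² b(x, y(t))`. Since `D_x b(x₀, y(t))` is affine in `t`,
`DQ(x₀) = 0`. Join `x₀` to `x₁` by a curve on which `D_y b(·, y(t))` is affine; nonnegative
cross-curvature makes `Q` convex along it, so `Q(x₀) ≤ Q(x₁)`, which is convexity of `b(x₁, y(t)) -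
b(x₀, y(t))` in `t` (`iteratedDeriv_two_curve_le`, `isConvexAlongSegments_of_nonnegCrossCurvature`).

A `b*`-convex `a` inherits the property as a supremum of functions `b(x, ·) - const`. The profit
from agent `x` is `b(x, y) - u(x) - a(y)` with `D_x b(x, y) = Du(x)`: averaging two functions `u`
moves `y` along a `b`-segment with respect to `x`, and the term `u(x)` is affine. Hence segment
convexity of `a` gives concavity of the profit under the integral sign. Conversely, testing
concavity on two functions `b(·, yᵢ) - z` and on agents concentrated near `x₀` recovers segment
convexity (`ProfitIsConcave.isConvexAlongSegments`).

Condition (2) is the first-order condition at an `x` attaining the supremum that defines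
`(a^b)^{b*}`. Conversely, under segment convexity a stationary point of `a - b(x, ·)` is a global
minimum (`forall_le_of_gradient_eq`), and having such an `x` for each `y ∈ Y` gives `b*`-convexity.
The delicate case is `x` on the boundary of `X`, where nothing is assumed about segments with
respect to `x`; it is reached as a limit from inside. -/

open Filter Topology in
/-- A diffeomorphism of `closure S` onto its range is open on the open set `S`, and its inverse is
as smooth on the image of `S` as the map itself. -/
theorem IsDiffeoOntoRange.exists_inverse {n : ℕ} {f : Eucl n → Eucl n} {S : Set (Eucl n)}
    (hd : IsDiffeoOntoRange f (closure S)) (hS : IsOpen S) {k : WithTop ℕ∞} (hk : k ≠ 0)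
    (hf : ContDiffOn ℝ k f S) :
    ∃ g : Eucl n → Eucl n, LeftInvOn g f (closure S) ∧ ContinuousOn g (f '' closure S) ∧
      IsOpen (f '' S) ∧ ContDiffOn ℝ k g (f '' S) := by
  obtain ⟨hf1, g, hg, hgf⟩ := hd
  have key : ∀ x ∈ S, ∃ f' : Eucl n ≃L[ℝ] Eucl n, HasFDerivAt f (f' : Eucl n →L[ℝ] Eucl n) x := by
    intro x hx
    have hfx : HasFDerivAt f (fderiv ℝ f x) x :=
      ((hf.contDiffAt (hS.mem_nhds hx)).differentiableAt hk).hasFDerivAt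
    have hxc : x ∈ closure S := subset_closure hx
    -- `g` is only differentiable within `f(cl S)`, but `f` maps a neighbourhood of `x` into that
    -- set. So the chain rule holds and exhibits a left inverse of `Df(x)`, which suffices in equal
    -- finite dimensions.
    have hgx := ((hg.differentiableOn one_ne_zero) (f x) (mem_image_of_mem f hxc)).hasFDerivWithinAt
    have hcomp := hgx.comp_hasFDerivAt x hfx (by
      filter_upwards [hS.mem_nhds hx] with x' hx'
      exact mem_image_of_mem f (subset_closure hx'))
    have hid : HasFDerivAt (g ∘ f) (ContinuousLinearMap.id ℝ (Eucl n)) x := by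
      refine (hasFDerivAt_id x).congr_of_eventuallyEq ?_
      filter_upwards [hS.mem_nhds hx] with x' hx'
      exact hgf (subset_closure hx')
    have heq := hcomp.unique hid
    have hinj : Function.Injective (fderiv ℝ f x : Eucl n →ₗ[ℝ] Eucl n) := by
      intro v w hvw
      have h1 := DFunLike.congr_fun heq v
      have h2 := DFunLike.congr_fun heq w
      simp only [ContinuousLinearMap.comp_apply, ContinuousLinearMap.id_apply] at h1 h2
      rw [← h1, ← h2]
      exact congrArg _ hvw
    refine ⟨(LinearEquiv.ofInjectiveEndo _ hinj).toContinuousLinearEquiv, ?_⟩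
    convert hfx using 1
    ext1 v
    exact congrFun (LinearEquiv.coe_ofInjectiveEndo _ hinj) v
  have hnhds : ∀ x ∈ S, f '' S ∈ 𝓝 (f x) := by
    intro x hx
    obtain ⟨f', hf'⟩ := key x hx
    have hs : HasStrictFDerivAt f (f' : Eucl n →L[ℝ] Eucl n) x :=
      (hf.contDiffAt (hS.mem_nhds hx)).hasStrictFDerivAt' hf' hk
    rw [← hs.map_nhds_eq_of_equiv]
    exact image_mem_map (hS.mem_nhds hx)
  have hopen : IsOpen (f '' S) := by
    rw [isOpen_iff_mem_nhds]
    rintro _ ⟨x, hx, rfl⟩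
    exact hnhds x hx
  refine ⟨g, hgf, hg.continuousOn, hopen, ?_⟩
  rintro _ ⟨x, hx, rfl⟩
  obtain ⟨f', hf'⟩ := key x hx
  have hfx := hf.contDiffAt (hS.mem_nhds hx)
  have hloc := hfx.to_localInverse hf' hk
  -- Near `f x` the local inverse takes values in `S`, where `g` undoes `f`; the two therefore agree
  -- there and `g` has the regularity of the local inverse.
  refine (hloc.congr_of_eventuallyEq ?_).contDiffWithinAt
  have hs : HasStrictFDerivAt f (f' : Eucl n →L[ℝ] Eucl n) x := hfx.hasStrictFDerivAt' hf' hk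
  have ht := hs.localInverse_tendsto
  filter_upwards [hs.eventually_right_inverse, ht (hS.mem_nhds hx)] with p hp hpS
  have := hgf (subset_closure hpS)
  rw [hp] at this
  exact this

theorem IsDiffeoOntoRange.injOn {n : ℕ} {f : Eucl n → Eucl n} {S : Set (Eucl n)}
    (hd : IsDiffeoOntoRange f S) : InjOn f S := by
  obtain ⟨-, g, -, hg⟩ := hd
  exact hg.injOn

theorem inner_gradient_eq_fderiv {n : ℕ} (f : Eucl n → ℝ) (x v : Eucl n) :
    inner ℝ (gradient f x) v = fderiv ℝ f x v := by
  simp [gradient]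

/-- Exchanges the two variables, so that the results about `D_x b` also serve for `D_y b`. -/
theorem contDiffOn_swap_closure_prod {n : ℕ} {b : Eucl n → Eucl n → ℝ} {X Y : Set (Eucl n)}
    {k : WithTop ℕ∞}
    (hb : ContDiffOn ℝ k (fun p : Eucl n × Eucl n => b p.1 p.2) (closure (X ×ˢ Y))) :
    ContDiffOn ℝ k (fun p : Eucl n × Eucl n => b p.2 p.1) (closure (Y ×ˢ X)) := by
  rw [closure_prod_eq] at *
  exact hb.comp (contDiff_snd.prodMk contDiff_fst).contDiffOn fun p hp => ⟨hp.2, hp.1⟩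

/-! ### Regularity of the partial gradients and of their inverses -/

section Regularity

variable {n : ℕ} {b : Eucl n → Eucl n → ℝ} {X Y : Set (Eucl n)} {k : WithTop ℕ∞}

theorem contDiffAt_fst_of_closure_prod (hX : IsOpen X)
    (hb : ContDiffOn ℝ k (fun p : Eucl n × Eucl n => b p.1 p.2) (closure (X ×ˢ Y)))
    {x y : Eucl n} (hx : x ∈ X) (hy : y ∈ closure Y) : ContDiffAt ℝ k (fun x' => b x' y) x := by
  rw [closure_prod_eq] at hb
  have : ContDiffOn ℝ k (fun x' => b x' y) X :=
    hb.comp (contDiff_id.prodMk contDiff_const).contDiffOn fun x' hx' => ⟨subset_closure hx', hy⟩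
  exact this.contDiffAt (hX.mem_nhds hx)

theorem contDiffAt_snd_of_closure_prod (hY : IsOpen Y)
    (hb : ContDiffOn ℝ k (fun p : Eucl n × Eucl n => b p.1 p.2) (closure (X ×ˢ Y)))
    {x y : Eucl n} (hx : x ∈ closure X) (hy : y ∈ Y) : ContDiffAt ℝ k (b x) y :=
  contDiffAt_fst_of_closure_prod (b := fun y' x' => b x' y') hY
    (contDiffOn_swap_closure_prod hb) hy hx

theorem contDiffOn_prod_of_closure_prod
    (hb : ContDiffOn ℝ k (fun p : Eucl n × Eucl n => b p.1 p.2) (closure (X ×ˢ Y))) :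
    ContDiffOn ℝ k (fun p : Eucl n × Eucl n => b p.1 p.2) (X ×ˢ Y) :=
  hb.mono subset_closure

/-- The partial gradient in `x` is continuous up to the boundary in `y`. -/
theorem continuousOn_gradX (hX : IsOpen X) (hk : 1 ≤ k)
    (hb : ContDiffOn ℝ k (fun p : Eucl n × Eucl n => b p.1 p.2) (closure (X ×ˢ Y))) :
    ContinuousOn (fun p : Eucl n × Eucl n => gradX b p.1 p.2) (X ×ˢ closure Y) := by
  rintro ⟨x₀, y₀⟩ ⟨hx₀, hy₀⟩
  rw [closure_prod_eq] at hb
  have h1 : ContDiffWithinAt ℝ (0 + 1) (fun p : Eucl n × Eucl n => b p.1 p.2)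
      (closure X ×ˢ closure Y) (x₀, y₀) :=
    (hb (x₀, y₀) ⟨subset_closure hx₀, hy₀⟩).of_le (by simpa using hk)
  rw [contDiffWithinAt_succ_iff_hasFDerivWithinAt' (by simp)] at h1
  obtain ⟨u, hu, -, -, f', hf', hc⟩ := h1
  have hmem : (x₀, y₀) ∈ closure X ×ˢ closure Y := ⟨subset_closure hx₀, hy₀⟩
  rw [insert_eq_of_mem hmem] at hu
  have hsub : X ×ˢ closure Y ⊆ closure X ×ˢ closure Y := prod_mono subset_closure subset_rfl
  have hc' : ContinuousWithinAt (fun p => (InnerProductSpace.toDual ℝ (Eucl n)).symm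
      ((f' p).comp (ContinuousLinearMap.inl ℝ (Eucl n) (Eucl n)))) (X ×ˢ closure Y) (x₀, y₀) := by
    have := (hc.continuousWithinAt).mono hsub
    exact (LinearIsometryEquiv.continuous _).continuousAt.comp_continuousWithinAt
      (this.clm_comp continuousWithinAt_const)
  -- The derivative `f'` within `cl(X) × cl(Y)` need not be unique at boundary points in `y`, but
  -- its restriction to the `x`-directions is, because `X` is open.
  have heq : ∀ p ∈ u ∩ (X ×ˢ closure Y), gradX b p.1 p.2 =
      (InnerProductSpace.toDual ℝ (Eucl n)).symm
      ((f' p).comp (ContinuousLinearMap.inl ℝ (Eucl n) (Eucl n))) := by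
    rintro ⟨x, y⟩ ⟨hpu, hx, hy⟩
    have hd := hf' (x, y) hpu
    have hin : HasFDerivAt (fun x' : Eucl n => (x', y))
        (ContinuousLinearMap.inl ℝ (Eucl n) (Eucl n)) x := hasFDerivAt_prodMk_left x y
    have := hd.comp_hasFDerivAt x hin (by
      filter_upwards [hX.mem_nhds hx] with x' hx'
      exact ⟨subset_closure hx', hy⟩)
    simp only [gradX, gradient]
    congr 1
    exact this.fderiv
  refine hc'.congr_of_eventuallyEq ?_ (heq _ ⟨mem_of_mem_nhdsWithin hmem hu, hx₀, hy₀⟩)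
  filter_upwards [nhdsWithin_mono _ hsub hu, self_mem_nhdsWithin] with p hp hp'
  exact heq p ⟨hp, hp'⟩

/-- The partial gradient in `x` loses one derivative. -/
theorem contDiffOn_gradX (hX : IsOpen X) (hY : IsOpen Y) {m : WithTop ℕ∞} (hk : m + 1 ≤ k)
    (hb : ContDiffOn ℝ k (fun p : Eucl n × Eucl n => b p.1 p.2) (X ×ˢ Y)) :
    ContDiffOn ℝ m (fun p : Eucl n × Eucl n => gradX b p.1 p.2) (X ×ˢ Y) := by
  have h1 := hb.fderiv_of_isOpen (hX.prod hY) hk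
  have h2 : ContDiffOn ℝ m (fun p => (InnerProductSpace.toDual ℝ (Eucl n)).symm
      ((fderiv ℝ (fun p : Eucl n × Eucl n => b p.1 p.2) p).comp
        (ContinuousLinearMap.inl ℝ (Eucl n) (Eucl n)))) (X ×ˢ Y) :=
    (LinearIsometryEquiv.contDiff _).comp_contDiffOn (h1.clm_comp contDiffOn_const)
  refine h2.congr ?_
  rintro ⟨x, y⟩ ⟨hx, hy⟩
  have hd : HasFDerivAt (fun p : Eucl n × Eucl n => b p.1 p.2) _ (x, y) :=
    ((hb.contDiffAt ((hX.prod hY).mem_nhds ⟨hx, hy⟩)).differentiableAt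
      (fun h => by simp [h] at hk)).hasFDerivAt
  have hin : HasFDerivAt (fun x' : Eucl n => (x', y))
      (ContinuousLinearMap.inl ℝ (Eucl n) (Eucl n)) x := hasFDerivAt_prodMk_left x y
  simp only [gradX, gradient]
  congr 1
  exact (hd.comp x hin).fderiv

/-- For fixed `x` in the open set `X`, an inverse of `y ↦ D_x b(x, y)` that is continuous up to the
boundary and smooth inside. -/
theorem exists_inverse_gradX (hX : IsOpen X) (hY : IsOpen Y)
    (hb : ContDiffOn ℝ 4 (fun p : Eucl n × Eucl n => b p.1 p.2) (closure (X ×ˢ Y)))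
    {x : Eucl n} (hx : x ∈ X) (hd : IsDiffeoOntoRange (fun y => gradX b x y) (closure Y)) :
    ∃ g : Eucl n → Eucl n, LeftInvOn g (gradX b x) (closure Y) ∧
      ContinuousOn g (gradX b x '' closure Y) ∧
      IsOpen (gradX b x '' Y) ∧ ContDiffOn ℝ 3 g (gradX b x '' Y) := by
  refine IsDiffeoOntoRange.exists_inverse hd hY (by norm_num) ?_
  have := contDiffOn_gradX (m := 3) hX hY (by norm_num) (contDiffOn_prod_of_closure_prod hb)
  exact this.comp (contDiff_const.prodMk contDiff_id).contDiffOn fun y hy => ⟨hx, hy⟩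

end Regularity

/-- Used to rescale curves to the parameter interval `[-1, 1]`. No smoothness is required, since
`deriv` obeys the affine change of variable even where it takes its default value. -/
theorem iteratedDeriv_two_comp_affine (f : ℝ → ℝ) (c e : ℝ) :
    iteratedDeriv 2 (fun τ => f (c + e * τ)) 0 = e ^ 2 * iteratedDeriv 2 f c := by
  have h1 : ∀ f : ℝ → ℝ, deriv (fun τ => f (c + e * τ)) = fun τ => e * deriv f (c + e * τ) := by
    intro f
    funext τ
    have := deriv_comp_mul_left e (fun s => f (c + s)) τ
    rw [deriv_comp_const_add] at this
    simpa using this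
  rw [iteratedDeriv_succ, iteratedDeriv_one, iteratedDeriv_succ, iteratedDeriv_one, h1,
    deriv_const_mul_field, h1]
  simp
  ring

/-! ### Mixed derivatives in a point and a real parameter -/

section Mixed

variable {E : Type*} [NormedAddCommGroup E] [NormedSpace ℝ E] {Ψ : E → ℝ → ℝ} {x : E} {t : ℝ}

theorem deriv_snd_eq_fderiv_uncurry
    (h : DifferentiableAt ℝ (fun p : E × ℝ => Ψ p.1 p.2) (x, t)) :
    deriv (Ψ x) t = fderiv ℝ (fun p : E × ℝ => Ψ p.1 p.2) (x, t) (0, 1) := by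
  have h1 := h.hasFDerivAt.comp t (hasFDerivAt_prodMk_right x t)
  have := h1.hasDerivAt.deriv
  simpa [Function.comp_def] using this

theorem fderiv_fst_eq_fderiv_uncurry
    (h : DifferentiableAt ℝ (fun p : E × ℝ => Ψ p.1 p.2) (x, t)) (v : E) :
    fderiv ℝ (fun x' => Ψ x' t) x v = fderiv ℝ (fun p : E × ℝ => Ψ p.1 p.2) (x, t) (v, 0) := by
  have hl : HasFDerivAt (fun x' : E => (x', t)) (ContinuousLinearMap.inl ℝ E ℝ) x :=
    hasFDerivAt_prodMk_left x t
  have h1 := h.hasFDerivAt.comp x hl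
  have := h1.fderiv
  simp only [Function.comp_def] at this
  rw [this]
  simp

open Filter Topology in
theorem eventually_deriv_snd_eq {m : WithTop ℕ∞} (hm : 1 ≤ m) (hm' : m ≠ ↑(⊤ : ℕ∞))
    (h : ContDiffAt ℝ m (fun p : E × ℝ => Ψ p.1 p.2) (x, t)) :
    (fun q : E × ℝ => deriv (Ψ q.1) q.2) =ᶠ[𝓝 (x, t)]
      fun q => fderiv ℝ (fun p : E × ℝ => Ψ p.1 p.2) q (0, 1) := by
  filter_upwards [h.eventually hm'] with q hq
  exact deriv_snd_eq_fderiv_uncurry (hq.differentiableAt (by rintro rfl; simp at hm))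

open Filter Topology in
theorem contDiffAt_deriv_snd {m : ℕ}
    (h : ContDiffAt ℝ (m + 1) (fun p : E × ℝ => Ψ p.1 p.2) (x, t)) :
    ContDiffAt ℝ m (fun p : E × ℝ => deriv (Ψ p.1) p.2) (x, t) := by
  have h1 : ContDiffAt ℝ m (fun q => fderiv ℝ (fun p : E × ℝ => Ψ p.1 p.2) q (0, 1)) (x, t) :=
    (h.fderiv_right le_rfl).clm_apply contDiffAt_const
  refine h1.congr_of_eventuallyEq (eventually_deriv_snd_eq ?_ ?_ h)
  · exact le_add_self
  · exact_mod_cast ENat.natCast_ne_top (m + 1)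

open Filter Topology in
/-- Partial derivatives in `t` and in `x` commute. -/
theorem deriv_fderiv_comm (h : ContDiffAt ℝ 2 (fun p : E × ℝ => Ψ p.1 p.2) (x, t)) (v : E) :
    deriv (fun t' => fderiv ℝ (fun x' => Ψ x' t') x v) t =
      fderiv ℝ (fun x' => deriv (Ψ x') t) x v := by
  set F : E × ℝ → ℝ := fun p => Ψ p.1 p.2 with hF
  have hev : ∀ᶠ q in 𝓝 (x, t), DifferentiableAt ℝ F q := by
    filter_upwards [h.eventually (by simp)] with q hq
    exact hq.differentiableAt (by simp)
  have h2 : HasFDerivAt (fderiv ℝ F) (fderiv ℝ (fderiv ℝ F) (x, t)) (x, t) :=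
    ((h.fderiv_right (m := 1) (by norm_num)).differentiableAt (by simp)).hasFDerivAt
  have hl : Tendsto (fun t' : ℝ => (x, t')) (𝓝 t) (𝓝 (x, t)) :=
    (Continuous.prodMk_right x).tendsto t
  have hr : Tendsto (fun x' : E => (x', t)) (𝓝 x) (𝓝 (x, t)) :=
    (Continuous.prodMk_left t).tendsto x
  have e1 : (fun t' => fderiv ℝ (fun x' => Ψ x' t') x v) =ᶠ[𝓝 t]
      fun t' => fderiv ℝ F (x, t') (v, 0) := by
    filter_upwards [hl.eventually hev] with t' ht'
    exact fderiv_fst_eq_fderiv_uncurry ht' v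
  have e2 : (fun x' => deriv (Ψ x') t) =ᶠ[𝓝 x] fun x' => fderiv ℝ F (x', t) (0, 1) := by
    filter_upwards [hr.eventually hev] with x' hx'
    exact deriv_snd_eq_fderiv_uncurry hx'
  rw [e1.deriv_eq, e2.fderiv_eq]
  have d1 := (h2.comp t (hasFDerivAt_prodMk_right x t)).clm_apply
    (hasFDerivAt_const ((v, 0) : E × ℝ) t)
  have hinl : HasFDerivAt (fun x' : E => (x', t)) (ContinuousLinearMap.inl ℝ E ℝ) x :=
    hasFDerivAt_prodMk_left x t
  have d2 := (h2.comp x hinl).clm_apply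
    (hasFDerivAt_const ((0, 1) : E × ℝ) x)
  have r1 := d1.hasDerivAt.deriv
  have r2 := DFunLike.congr_fun d2.fderiv v
  simp only [Function.comp_def] at r1 r2
  rw [r1, r2]
  have hsymm := (h.isSymmSndFDerivAt (by simp)) (v, 0) (0, 1)
  simp [hsymm]

end Mixed

/-! ### Cross-curvature along curves -/

section Curve

variable {n : ℕ} {b : Eucl n → Eucl n → ℝ} {X Y : Set (Eucl n)} {T : Set ℝ} {y : ℝ → Eucl n}

theorem hasFDerivAt_slice_snd {F : Type*} [NormedAddCommGroup F] [NormedSpace ℝ F]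
    {B : Eucl n × Eucl n → F} {x y : Eucl n} (h : DifferentiableAt ℝ B (x, y)) :
    HasFDerivAt (fun y' => B (x, y'))
      ((fderiv ℝ B (x, y)).comp (ContinuousLinearMap.inr ℝ (Eucl n) (Eucl n))) y :=
  h.hasFDerivAt.comp y (hasFDerivAt_prodMk_right x y)

open Filter Topology in
/-- The second derivative of `t ↦ b(x, y(t))` is of class `C²` in `x`. -/
theorem contDiffOn_iteratedDeriv_two_curve (hX : IsOpen X) (hY : IsOpen Y)
    (hb : ContDiffOn ℝ 4 (fun p : Eucl n × Eucl n => b p.1 p.2) (X ×ˢ Y))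
    (hT : IsOpen T) (hy : ContDiffOn ℝ 3 y T) (hyY : MapsTo y T Y) {t : ℝ} (ht : t ∈ T) :
    ContDiffOn ℝ 2 (fun x => iteratedDeriv 2 (fun t' => b x (y t')) t) X := by
  have hXY := hX.prod hY
  set B : Eucl n × Eucl n → ℝ := fun p => b p.1 p.2 with hB
  set B1 : Eucl n × Eucl n → Eucl n →L[ℝ] ℝ := fun p =>
    (fderiv ℝ B p).comp (ContinuousLinearMap.inr ℝ (Eucl n) (Eucl n)) with hB1
  set B2 : Eucl n × Eucl n → Eucl n →L[ℝ] Eucl n →L[ℝ] ℝ := fun p =>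
    (fderiv ℝ B1 p).comp (ContinuousLinearMap.inr ℝ (Eucl n) (Eucl n)) with hB2
  have c1 : ContDiffOn ℝ 3 B1 (X ×ˢ Y) :=
    (hb.fderiv_of_isOpen hXY (by norm_num)).clm_comp contDiffOn_const
  have c2 : ContDiffOn ℝ 2 B2 (X ×ˢ Y) :=
    (c1.fderiv_of_isOpen hXY (by norm_num)).clm_comp contDiffOn_const
  have hy1 : ∀ s ∈ T, HasDerivAt y (deriv y s) s := fun s hs =>
    ((hy.contDiffAt (hT.mem_nhds hs)).differentiableAt (by simp)).hasDerivAt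
  have hy2 : HasDerivAt (deriv y) (deriv (deriv y) t) t := by
    have : ContDiffOn ℝ 2 (deriv y) T := hy.deriv_of_isOpen hT (by norm_num)
    exact ((this.contDiffAt (hT.mem_nhds ht)).differentiableAt (by simp)).hasDerivAt
  -- Second-order chain rule. The velocity and acceleration of `y` do not involve `x`, so the
  -- regularity in `x` is that of the first and second `y`-derivatives of `b`.
  have key : ∀ x ∈ X, iteratedDeriv 2 (fun t' => b x (y t')) t =
      B2 (x, y t) (deriv y t) (deriv y t) + B1 (x, y t) (deriv (deriv y) t) := by
    intro x hx
    have e1 : deriv (fun t' => b x (y t')) =ᶠ[𝓝 t] fun t' => B1 (x, y t') (deriv y t') := by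
      filter_upwards [hT.mem_nhds ht] with s hs
      have hd : DifferentiableAt ℝ B (x, y s) :=
        (hb.contDiffAt (hXY.mem_nhds ⟨hx, hyY hs⟩)).differentiableAt (by simp)
      exact ((hasFDerivAt_slice_snd hd).comp_hasDerivAt s (hy1 s hs)).deriv
    have hd1 : DifferentiableAt ℝ B1 (x, y t) :=
      (c1.contDiffAt (hXY.mem_nhds ⟨hx, hyY ht⟩)).differentiableAt (by simp)
    rw [iteratedDeriv_succ, iteratedDeriv_one, e1.deriv_eq]
    exact (((hasFDerivAt_slice_snd hd1).comp_hasDerivAt t (hy1 t ht)).clm_apply hy2).deriv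
  refine ContDiffOn.congr ?_ key
  have hin : ContDiffOn ℝ 2 (fun x : Eucl n => (x, y t)) X :=
    (contDiff_id.prodMk contDiff_const).contDiffOn
  have hm : MapsTo (fun x : Eucl n => (x, y t)) X (X ×ˢ Y) := fun x hx => ⟨hx, hyY ht⟩
  exact (((c2.comp hin hm).clm_apply contDiffOn_const).clm_apply contDiffOn_const).add
    (((c1.of_le (by norm_num)).comp hin hm).clm_apply contDiffOn_const)

open Filter Topology in
/-- If `t ↦ D_x b(x₀, y(t))` is affine then the second derivative of `t ↦ b(x, y(t))` is stationary
in `x` at `x₀`. -/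
theorem fderiv_iteratedDeriv_two_curve_eq_zero (hX : IsOpen X)
    (hb : ContDiffOn ℝ 4 (fun p : Eucl n × Eucl n => b p.1 p.2) (X ×ˢ Y))
    (hT : IsOpen T) (hy : ContDiffOn ℝ 3 y T) (hyY : MapsTo y T Y) {t : ℝ} (ht : t ∈ T)
    {x : Eucl n} (hx : x ∈ X) {p q : Eucl n} (haff : ∀ s ∈ T, gradX b x (y s) = p + s • q) :
    fderiv ℝ (fun x' => iteratedDeriv 2 (fun t' => b x' (y t')) t) x = 0 := by
  have hΦ : ∀ s ∈ T, ContDiffAt ℝ 3 (fun r : Eucl n × ℝ => b r.1 (y r.2)) (x, s) := by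
    intro s hs
    have h1 : ContDiffOn ℝ 3 (fun r : Eucl n × ℝ => b r.1 (y r.2)) (X ×ˢ T) :=
      (hb.of_le (by norm_num)).comp (contDiffOn_fst.prodMk
        (hy.comp contDiffOn_snd fun r hr => hr.2)) fun r hr => ⟨hr.1, hyY hr.2⟩
    exact h1.contDiffAt ((hX.prod hT).mem_nhds ⟨hx, hs⟩)
  ext v
  -- Exchanging derivatives, the `x`-derivative of `∂ₜ b(x, y(t))` is the velocity `q` of the affine
  -- curve. It is constant in `t`, so a second exchange makes the derivative of `∂ₜ²` vanish.
  have h1 : ∀ s ∈ T, fderiv ℝ (fun x' => deriv (fun t' => b x' (y t')) s) x v = inner ℝ q v := by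
    intro s hs
    rw [← deriv_fderiv_comm (Ψ := fun x' t' => b x' (y t')) ((hΦ s hs).of_le (by norm_num)) v]
    have e : (fun t' => fderiv ℝ (fun x' => b x' (y t')) x v) =ᶠ[𝓝 s]
        fun t' => inner ℝ p v + t' * inner ℝ q v := by
      filter_upwards [hT.mem_nhds hs] with t' ht'
      rw [← inner_gradient_eq_fderiv]
      change inner ℝ (gradX b x (y t')) v = _
      rw [haff t' ht', inner_add_left, real_inner_smul_left]
    rw [e.deriv_eq]
    simp
  have h2 : ContDiffAt ℝ 2 (fun r : Eucl n × ℝ => deriv (fun t' => b r.1 (y t')) r.2) (x, t) :=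
    contDiffAt_deriv_snd (m := 2) (Ψ := fun x' t' => b x' (y t')) (by
      have := hΦ t ht
      norm_num
      exact this)
  have h3 := deriv_fderiv_comm (Ψ := fun x' s => deriv (fun t' => b x' (y t')) s) h2 v
  have e : (fun s => fderiv ℝ (fun x' => deriv (fun t' => b x' (y t')) s) x v) =ᶠ[𝓝 t]
      fun _ => inner ℝ q v := by
    filter_upwards [hT.mem_nhds ht] with s hs
    exact h1 s hs
  rw [e.deriv_eq, deriv_const] at h3
  simp only [iteratedDeriv_succ, iteratedDeriv_zero]
  rw [zero_apply]
  exact h3.symm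

theorem exists_affine_mem_of_isOpen {S : Set ℝ} (hS : IsOpen S) {s : ℝ} (hs : s ∈ S) :
    ∃ ε > 0, ∀ δ, 0 < δ → δ ≤ ε → ∀ σ ∈ Icc (-1 : ℝ) 1, s + δ * σ ∈ S := by
  obtain ⟨ε, hε, hball⟩ := Metric.isOpen_iff.1 hS s hs
  refine ⟨ε / 2, by positivity, fun δ hδ hδε σ hσ => hball ?_⟩
  rw [Metric.mem_ball, Real.dist_eq, add_sub_cancel_left, abs_mul, abs_of_pos hδ]
  have : |σ| ≤ 1 := abs_le.2 hσ
  nlinarith [abs_nonneg σ]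

/-- The curvature hypothesis at an interior point of a pair of curves. -/
theorem NonnegCrossCurvature.iteratedDeriv_nonneg (hcurv : NonnegCrossCurvature b X Y)
    {S : Set ℝ} {ξ : ℝ → Eucl n} (hS : IsOpen S) (hT : IsOpen T)
    (hξ : ContDiffOn ℝ 2 ξ S) (hy : ContDiffOn ℝ 2 y T) (hξX : MapsTo ξ S X) (hyY : MapsTo y T Y)
    {s t : ℝ} (hs : s ∈ S) (ht : t ∈ T) {p q : Eucl n}
    (haff : ∀ σ ∈ S, gradY b (ξ σ) (y t) = p + σ • q) :
    0 ≤ iteratedDeriv 2 (fun σ => iteratedDeriv 2 (fun τ => b (ξ σ) (y τ)) t) s := by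
  obtain ⟨ε₁, hε₁, h₁⟩ := exists_affine_mem_of_isOpen hS hs
  obtain ⟨ε₂, hε₂, h₂⟩ := exists_affine_mem_of_isOpen hT ht
  set ε := min ε₁ ε₂
  have hε : 0 < ε := lt_min hε₁ hε₂
  have m₁ := h₁ ε hε (min_le_left _ _)
  have m₂ := h₂ ε hε (min_le_right _ _)
  have hsm : ∀ c : ℝ, ContDiff ℝ 2 (fun σ : ℝ => c + ε * σ) := fun c =>
    contDiff_const.add (contDiff_const.mul contDiff_id)
  -- Both curves are recentred at `(s, t)` and slowed down by `ε` to fit `[-1, 1]`; the fourth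
  -- derivative only acquires the positive factor `ε ^ 2 * ε ^ 2`.
  have h := hcurv (fun σ => ξ (s + ε * σ)) (fun τ => y (t + ε * τ))
    (hξ.comp (hsm s).contDiffOn m₁) (hy.comp (hsm t).contDiffOn m₂)
    (fun σ hσ => hξX (m₁ σ hσ)) (fun τ hτ => hyY (m₂ τ hτ))
    (Or.inl ⟨p + s • q, ε • q, fun σ hσ => by
      simp only [mul_zero, add_zero]
      rw [haff _ (m₁ σ hσ)]
      module⟩)
  have e1 : (fun σ => iteratedDeriv 2 (fun τ => b (ξ (s + ε * σ)) (y (t + ε * τ))) 0) =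
      fun σ => ε ^ 2 * (fun σ' => iteratedDeriv 2 (fun τ => b (ξ σ') (y τ)) t) (s + ε * σ) := by
    funext σ
    exact iteratedDeriv_two_comp_affine (fun τ => b (ξ (s + ε * σ)) (y τ)) t ε
  rw [e1, iteratedDeriv_two_comp_affine (fun σ' => ε ^ 2 *
    (fun σ' => iteratedDeriv 2 (fun τ => b (ξ σ') (y τ)) t) σ') s ε,
    iteratedDeriv_const_mul_field] at h
  have h4 : 0 < ε ^ 2 := by positivity
  exact nonneg_of_mul_nonneg_right (nonneg_of_mul_nonneg_right h h4) h4

/-- Along a curve `y` for which `t ↦ D_x b(x₀, y(t))` is affine, the second derivative of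
`t ↦ b(x, y(t))` is least at `x = x₀`. -/
theorem iteratedDeriv_two_curve_le (hX : IsOpen X) (hY : IsOpen Y)
    (hb : ContDiffOn ℝ 4 (fun p : Eucl n × Eucl n => b p.1 p.2) (closure (X ×ˢ Y)))
    (htwist : BiTwist b X Y) (hconvex : BiConvexDomains b X Y) (hcurv : NonnegCrossCurvature b X Y)
    (hT : IsOpen T) (hy : ContDiffOn ℝ 3 y T) (hyY : MapsTo y T Y) {t : ℝ} (ht : t ∈ T)
    {x₀ x₁ : Eucl n} (hx₀ : x₀ ∈ X) (hx₁ : x₁ ∈ X) {p q : Eucl n}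
    (haff : ∀ s ∈ T, gradX b x₀ (y s) = p + s • q) :
    iteratedDeriv 2 (fun t' => b x₀ (y t')) t ≤ iteratedDeriv 2 (fun t' => b x₁ (y t')) t := by
  have hb' := contDiffOn_prod_of_closure_prod hb
  obtain ⟨h, hinv, -, hopen, hsmooth⟩ := exists_inverse_gradX (b := fun y' x' => b x' y') hY hX
    (contDiffOn_swap_closure_prod hb) (hyY ht) (htwist.2 (y t) (hyY ht))
  set f : Eucl n → Eucl n := gradX (fun y' x' => b x' y') (y t) with hf
  set R := f '' X with hR
  have hRconv : Convex ℝ R := hconvex.2 (y t) (hyY ht)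
  -- The straight segment in `D_y b(X, y(t))`, whose pullback `ξ` joins `x₀` to `x₁`. The image
  -- being open and convex, `ξ` is defined on an open set containing `[0, 1]`.
  set c : ℝ → Eucl n := fun s => f x₀ + s • (f x₁ - f x₀) with hc
  have hcsm : ContDiff ℝ 3 c := contDiff_const.add (contDiff_id.smul contDiff_const)
  set S : Set ℝ := c ⁻¹' R with hSdef
  have hS : IsOpen S := hopen.preimage hcsm.continuous
  have hIcc : Icc (0 : ℝ) 1 ⊆ S := fun s hs =>
    hRconv.add_smul_sub_mem (mem_image_of_mem f hx₀) (mem_image_of_mem f hx₁) hs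
  set ξ : ℝ → Eucl n := fun s => h (c s) with hξdef
  have hξ : ContDiffOn ℝ 3 ξ S := hsmooth.comp hcsm.contDiffOn fun s hs => hs
  have hξ' : ∀ s ∈ S, ξ s ∈ X ∧ f (ξ s) = c s := by
    intro s hs
    obtain ⟨x, hx, hxs⟩ := hs
    have : ξ s = x := by
      simp only [hξdef]
      rw [← hxs]
      exact hinv (subset_closure hx)
    rw [this]
    exact ⟨hx, hxs⟩
  have hξ0 : ξ 0 = x₀ := by
    simp only [hξdef, hc, zero_smul, add_zero]
    exact hinv (subset_closure hx₀)
  have hξ1 : ξ 1 = x₁ := by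
    simp only [hξdef, hc, one_smul, add_sub_cancel]
    exact hinv (subset_closure hx₁)
  set Q : Eucl n → ℝ := fun x => iteratedDeriv 2 (fun t' => b x (y t')) t with hQdef
  have hQ : ContDiffOn ℝ 2 Q X := contDiffOn_iteratedDeriv_two_curve hX hY hb' hT hy hyY ht
  have hQ0 : fderiv ℝ Q x₀ = 0 :=
    fderiv_iteratedDeriv_two_curve_eq_zero hX hb' hT hy hyY ht hx₀ haff
  have hG : ContDiffOn ℝ 2 (fun s => Q (ξ s)) S :=
    hQ.comp (hξ.of_le (by norm_num)) fun s hs => (hξ' s hs).1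
  have hG1 : ContDiffOn ℝ 1 (deriv fun s => Q (ξ s)) S := hG.deriv_of_isOpen hS (by norm_num)
  have hconv : ConvexOn ℝ (Icc 0 1) fun s => Q (ξ s) := by
    refine convexOn_of_deriv2_nonneg' (convex_Icc 0 1)
      ((hG.differentiableOn (by simp)).mono hIcc)
      ((hG1.differentiableOn (by simp)).mono hIcc) fun s hs => ?_
    rw [← iteratedDeriv_eq_iterate]
    refine hcurv.iteratedDeriv_nonneg hS hT (hξ.of_le (by norm_num)) (hy.of_le (by norm_num))
      (fun s hs => (hξ' s hs).1) hyY (hIcc hs) ht (p := f x₀) (q := f x₁ - f x₀) fun σ hσ => ?_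
    exact (hξ' σ hσ).2
  have hder : HasDerivAt (fun s => Q (ξ s)) 0 0 := by
    have h0 : (0 : ℝ) ∈ S := hIcc (by simp)
    have hξd : HasDerivAt ξ (deriv ξ 0) 0 :=
      ((hξ.contDiffAt (hS.mem_nhds h0)).differentiableAt (by simp)).hasDerivAt
    have hQd : HasFDerivAt Q (fderiv ℝ Q (ξ 0)) (ξ 0) := by
      rw [hξ0]
      exact ((hQ.contDiffAt (hX.mem_nhds hx₀)).differentiableAt (by simp)).hasFDerivAt
    have := hQd.comp_hasDerivAt 0 hξd
    rwa [hξ0, hQ0, zero_apply] at this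
  -- A convex function with zero derivative at `0` has nonnegative slope from `0` to `1`.
  have := hconv.le_slope_of_hasDerivAt (by simp) (by simp) zero_lt_one hder
  simp only [slope, hξ0, hξ1, sub_zero, inv_one, one_smul, vsub_eq_sub, sub_nonneg] at this
  exact this

/-- Convexity of `t ↦ b(x₁, y(t)) - b(x₀, y(t))` when `t ↦ D_x b(x₀, y(t))` is affine. -/
theorem convexOn_curve_sub (hX : IsOpen X) (hY : IsOpen Y)
    (hb : ContDiffOn ℝ 4 (fun p : Eucl n × Eucl n => b p.1 p.2) (closure (X ×ˢ Y)))
    (htwist : BiTwist b X Y) (hconvex : BiConvexDomains b X Y) (hcurv : NonnegCrossCurvature b X Y)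
    (hT : IsOpen T) (hy : ContDiffOn ℝ 3 y T) (hyY : MapsTo y T Y) (hIcc : Icc 0 1 ⊆ T)
    {x₀ x₁ : Eucl n} (hx₀ : x₀ ∈ X) (hx₁ : x₁ ∈ X) {p q : Eucl n}
    (haff : ∀ s ∈ T, gradX b x₀ (y s) = p + s • q) :
    ConvexOn ℝ (Icc 0 1) fun t => b x₁ (y t) - b x₀ (y t) := by
  have hb' := contDiffOn_prod_of_closure_prod hb
  have hc : ∀ x ∈ X, ContDiffOn ℝ 3 (fun t => b x (y t)) T := fun x hx =>
    (hb'.of_le (by norm_num)).comp (contDiffOn_const.prodMk hy) fun t ht => ⟨hx, hyY ht⟩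
  have hsub := (hc x₁ hx₁).sub (hc x₀ hx₀)
  have hsub1 : ContDiffOn ℝ 2 (deriv fun t => b x₁ (y t) - b x₀ (y t)) T :=
    hsub.deriv_of_isOpen hT (by norm_num)
  refine convexOn_of_deriv2_nonneg' (convex_Icc 0 1)
    ((hsub.differentiableOn (by simp)).mono hIcc)
    ((hsub1.differentiableOn (by simp)).mono hIcc) fun t ht => ?_
  have hnt := hT.mem_nhds (hIcc ht)
  rw [← iteratedDeriv_eq_iterate, iteratedDeriv_fun_sub
    (((hc x₁ hx₁).contDiffAt hnt).of_le (by norm_num))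
    (((hc x₀ hx₀).contDiffAt hnt).of_le (by norm_num)), sub_nonneg]
  exact iteratedDeriv_two_curve_le hX hY hb htwist hconvex hcurv hT hy hyY (hIcc ht) hx₀ hx₁ haff

end Curve

/-! ### Convexity along `b`-segments -/

/-- `φ - b(x₀, ·)` is convex along all `b`-segments of `cl(Y)` with respect to `x₀`. -/
def IsConvexAlongSegments {n : ℕ} (b : Eucl n → Eucl n → ℝ) (Y : Set (Eucl n)) (x₀ : Eucl n)
    (φ : Eucl n → ℝ) : Prop :=
  ∀ y₀ ∈ closure Y, ∀ y₁ ∈ closure Y, ∀ y ∈ closure Y, ∀ α β : ℝ, 0 ≤ α → 0 ≤ β → α + β = 1 →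
    gradX b x₀ y = α • gradX b x₀ y₀ + β • gradX b x₀ y₁ →
    φ y - b x₀ y ≤ α * (φ y₀ - b x₀ y₀) + β * (φ y₁ - b x₀ y₁)

section Segments

variable {n : ℕ} {b : Eucl n → Eucl n → ℝ} {X Y : Set (Eucl n)}

open Filter Topology in
theorem tendsto_of_continuousOn_closure_prod
    (hb : ContinuousOn (fun p : Eucl n × Eucl n => b p.1 p.2) (closure (X ×ˢ Y)))
    {ι : Type*} {l : Filter ι} {xs ys : ι → Eucl n} {x y : Eucl n}
    (hx : Tendsto xs l (𝓝 x)) (hy : Tendsto ys l (𝓝 y)) (hxs : ∀ᶠ i in l, xs i ∈ closure X)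
    (hys : ∀ᶠ i in l, ys i ∈ closure Y) (hxX : x ∈ closure X) (hyY : y ∈ closure Y) :
    Tendsto (fun i => b (xs i) (ys i)) l (𝓝 (b x y)) := by
  rw [closure_prod_eq] at hb
  have h1 : Tendsto (fun i => (xs i, ys i)) l (𝓝[closure X ×ˢ closure Y] (x, y)) := by
    refine tendsto_nhdsWithin_iff.2 ⟨hx.prodMk_nhds hy, ?_⟩
    filter_upwards [hxs, hys] with i h1 h2 using ⟨h1, h2⟩
  exact (hb (x, y) ⟨hxX, hyY⟩).tendsto.comp h1

open Filter Topology in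
theorem tendsto_of_continuousOn_closure {a : Eucl n → ℝ} (ha : ContinuousOn a (closure Y))
    {ι : Type*} {l : Filter ι} {ys : ι → Eucl n} {y : Eucl n}
    (hy : Tendsto ys l (𝓝 y)) (hys : ∀ᶠ i in l, ys i ∈ closure Y) (hyY : y ∈ closure Y) :
    Tendsto (fun i => a (ys i)) l (𝓝 (a y)) :=
  (ha y hyY).tendsto.comp (tendsto_nhdsWithin_iff.2 ⟨hy, hys⟩)

/-- For interior endpoints the segment is the pullback under `D_x b(x₀, ·)` of a straight segment.
Convexity of the image keeps it in `Y`, and injectivity identifies `y` with its point at parameter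
`β`. -/
theorem segment_ineq_of_mem (hX : IsOpen X) (hY : IsOpen Y)
    (hb : ContDiffOn ℝ 4 (fun p : Eucl n × Eucl n => b p.1 p.2) (closure (X ×ˢ Y)))
    (htwist : BiTwist b X Y) (hconvex : BiConvexDomains b X Y) (hcurv : NonnegCrossCurvature b X Y)
    {x₀ x₁ y₀ y₁ y : Eucl n} (hx₀ : x₀ ∈ X) (hx₁ : x₁ ∈ X) (hy₀ : y₀ ∈ Y) (hy₁ : y₁ ∈ Y)
    (hy : y ∈ Y) {α β : ℝ} (hα : 0 ≤ α) (hβ : 0 ≤ β) (hαβ : α + β = 1)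
    (h : gradX b x₀ y = α • gradX b x₀ y₀ + β • gradX b x₀ y₁) :
    b x₁ y - b x₀ y ≤ α * (b x₁ y₀ - b x₀ y₀) + β * (b x₁ y₁ - b x₀ y₁) := by
  obtain ⟨g, hinv, -, hopen, hsmooth⟩ := exists_inverse_gradX hX hY hb hx₀ (htwist.1 x₀ hx₀)
  have hconv : Convex ℝ (gradX b x₀ '' Y) := hconvex.1 x₀ hx₀
  set c : ℝ → Eucl n := fun s => gradX b x₀ y₀ + s • (gradX b x₀ y₁ - gradX b x₀ y₀) with hc
  have hcsm : ContDiff ℝ 3 c := contDiff_const.add (contDiff_id.smul contDiff_const)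
  set T : Set ℝ := c ⁻¹' (gradX b x₀ '' Y) with hTdef
  have hT : IsOpen T := hopen.preimage hcsm.continuous
  have hIcc : Icc (0 : ℝ) 1 ⊆ T := fun s hs =>
    hconv.add_smul_sub_mem (mem_image_of_mem _ hy₀) (mem_image_of_mem _ hy₁) hs
  have hg : ∀ s ∈ T, g (c s) ∈ Y ∧ gradX b x₀ (g (c s)) = c s := by
    rintro s ⟨x, hx, hxs⟩
    have : g (c s) = x := by rw [← hxs]; exact hinv (subset_closure hx)
    rw [this]
    exact ⟨hx, hxs⟩
  have hcv := convexOn_curve_sub hX hY hb htwist hconvex hcurv hT (y := fun s => g (c s))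
    (hsmooth.comp hcsm.contDiffOn fun s hs => hs) (fun s hs => (hg s hs).1) hIcc hx₀ hx₁
    (fun s hs => (hg s hs).2)
  have h0 : g (c 0) = y₀ := by
    simp only [hc, zero_smul, add_zero]
    exact hinv (subset_closure hy₀)
  have h1 : g (c 1) = y₁ := by
    simp only [hc, one_smul, add_sub_cancel]
    exact hinv (subset_closure hy₁)
  have hβ' : g (c β) = y := by
    have : c β = gradX b x₀ y := by
      rw [h, hc, ← sub_eq_of_eq_add' hαβ.symm]
      module
    rw [this]
    exact hinv (subset_closure hy)
  have := hcv.2 (x := 0) (y := 1) (by simp) (by simp) hα hβ hαβ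
  simpa [h0, h1, hβ'] using this

open Filter Topology in
/-- Nonnegative cross-curvature: `b(x₁, ·) - b(x₀, ·)` is convex along `b`-segments with respect
to `x₀`, up to the boundary. -/
theorem isConvexAlongSegments_of_nonnegCrossCurvature (hX : IsOpen X) (hY : IsOpen Y)
    (hb : ContDiffOn ℝ 4 (fun p : Eucl n × Eucl n => b p.1 p.2) (closure (X ×ˢ Y)))
    (htwist : BiTwist b X Y) (hconvex : BiConvexDomains b X Y) (hcurv : NonnegCrossCurvature b X Y)
    {x₀ x₁ : Eucl n} (hx₀ : x₀ ∈ X) (hx₁ : x₁ ∈ closure X) :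
    IsConvexAlongSegments b Y x₀ (b x₁) := by
  intro y₀ hy₀ y₁ hy₁ y hy α β hα hβ hαβ h
  obtain ⟨g, hinv, hgc, -, -⟩ := exists_inverse_gradX hX hY hb hx₀ (htwist.1 x₀ hx₀)
  have hconv : Convex ℝ (gradX b x₀ '' Y) := hconvex.1 x₀ hx₀
  obtain ⟨xs, hxs, hxt⟩ := mem_closure_iff_seq_limit.1 hx₁
  obtain ⟨us, hus, hut⟩ := mem_closure_iff_seq_limit.1 hy₀
  obtain ⟨vs, hvs, hvt⟩ := mem_closure_iff_seq_limit.1 hy₁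
  have hmix : ∀ k, ∃ w ∈ Y, gradX b x₀ w = α • gradX b x₀ (us k) + β • gradX b x₀ (vs k) :=
    fun k => hconv (mem_image_of_mem _ (hus k)) (mem_image_of_mem _ (hvs k)) hα hβ hαβ
  choose ws hws hwe using hmix
  have hf : ContinuousOn (gradX b x₀) (closure Y) := (htwist.1 x₀ hx₀).1.continuousOn
  have hgrad : ∀ {zs : ℕ → Eucl n} {z}, Tendsto zs atTop (𝓝 z) → (∀ k, zs k ∈ Y) →
      z ∈ closure Y → Tendsto (fun k => gradX b x₀ (zs k)) atTop (𝓝 (gradX b x₀ z)) := by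
    intro zs z hz hzY hzc
    exact (hf z hzc).tendsto.comp (tendsto_nhdsWithin_iff.2
      ⟨hz, Eventually.of_forall fun k => subset_closure (hzY k)⟩)
  -- The interior mixtures converge to `y` because the inverse of `D_x b(x₀, ·)` is continuous on
  -- the image of all of `cl(Y)`. This carries the inequality to the boundary.
  have hwt : Tendsto ws atTop (𝓝 y) := by
    have h1 : Tendsto (fun k => gradX b x₀ (ws k)) atTop
        (𝓝[gradX b x₀ '' closure Y] (gradX b x₀ y)) := by
      refine tendsto_nhdsWithin_iff.2 ⟨?_, Eventually.of_forall fun k =>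
        mem_image_of_mem _ (subset_closure (hws k))⟩
      rw [h]
      simp only [hwe]
      exact ((hgrad hut hus hy₀).const_smul α).add ((hgrad hvt hvs hy₁).const_smul β)
    have h2 := (hgc _ (mem_image_of_mem _ hy)).tendsto.comp h1
    rw [hinv hy] at h2
    refine h2.congr fun k => ?_
    exact hinv (subset_closure (hws k))
  have hbt : ∀ {ps qs : ℕ → Eucl n} {p q}, Tendsto ps atTop (𝓝 p) → Tendsto qs atTop (𝓝 q) →
      (∀ k, ps k ∈ X) → (∀ k, qs k ∈ Y) → p ∈ closure X → q ∈ closure Y →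
      Tendsto (fun k => b (ps k) (qs k)) atTop (𝓝 (b p q)) := by
    intro ps qs p q hp hq hpX hqY hpc hqc
    exact tendsto_of_continuousOn_closure_prod hb.continuousOn hp hq
      (Eventually.of_forall fun k => subset_closure (hpX k))
      (Eventually.of_forall fun k => subset_closure (hqY k)) hpc hqc
  have hct : Tendsto (fun _ : ℕ => x₀) atTop (𝓝 x₀) := tendsto_const_nhds
  have hx₀c := subset_closure hx₀
  refine le_of_tendsto_of_tendsto'
    ((hbt hxt hwt hxs hws hx₁ hy).sub (hbt hct hwt (fun _ => hx₀) hws hx₀c hy))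
    ((((hbt hxt hut hxs hus hx₁ hy₀).sub (hbt hct hut (fun _ => hx₀) hus hx₀c hy₀)).const_mul
      α).add (((hbt hxt hvt hxs hvs hx₁ hy₁).sub
        (hbt hct hvt (fun _ => hx₀) hvs hx₀c hy₁)).const_mul β)) fun k => ?_
  exact segment_ineq_of_mem hX hY hb htwist hconvex hcurv hx₀ (hxs k) (hus k) (hvs k) (hws k)
    hα hβ hαβ (hwe k)

end Segments

/-! ### The `b`- and `b*`-transforms -/

section Transforms

variable {n : ℕ} {b : Eucl n → Eucl n → ℝ} {X Y : Set (Eucl n)} {a : Eucl n → ℝ}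

/-- Compactness of `cl(Y)` bounds the set above; otherwise `sSup` would take its default value and
the inequality could fail. -/
theorem sub_le_bTransform (hYbdd : Bornology.IsBounded Y)
    (hb : ContinuousOn (fun p : Eucl n × Eucl n => b p.1 p.2) (closure (X ×ˢ Y)))
    (ha : ContinuousOn a (closure Y)) {x y : Eucl n} (hx : x ∈ closure X) (hy : y ∈ closure Y) :
    b x y - a y ≤ bTransform b Y a x := by
  have hc : ContinuousOn (fun y => b x y - a y) (closure Y) := by
    rw [closure_prod_eq] at hb
    have h1 : ContinuousOn (fun y => b x y) (closure Y) :=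
      hb.comp (Continuous.prodMk_right x).continuousOn fun y hy => ⟨hx, hy⟩
    exact h1.sub ha
  exact le_csSup (hYbdd.isCompact_closure.image_of_continuousOn hc).bddAbove
    (mem_image_of_mem (fun y => b x y - a y) hy)

theorem bTransform_eq_of_forall_le {x y : Eucl n} (hy : y ∈ closure Y)
    (h : ∀ y' ∈ closure Y, a y - b x y ≤ a y' - b x y') : bTransform b Y a x = b x y - a y := by
  refine IsGreatest.csSup_eq ⟨mem_image_of_mem (fun y => b x y - a y) hy, ?_⟩
  rintro _ ⟨y', hy', rfl⟩
  have := h y' hy'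
  simp only
  linarith

/-- A `b*`-convex function is a supremum of functions convex along `b`-segments. -/
theorem IsBStarConvex.isConvexAlongSegments (hXne : X.Nonempty) (hYbdd : Bornology.IsBounded Y)
    (hb : ContinuousOn (fun p : Eucl n × Eucl n => b p.1 p.2) (closure (X ×ˢ Y)))
    (ha : ContinuousOn a (closure Y)) (h : IsBStarConvex b X Y a) {x₀ : Eucl n}
    (hseg : ∀ x ∈ closure X, IsConvexAlongSegments b Y x₀ (b x)) :
    IsConvexAlongSegments b Y x₀ a := by
  intro y₀ hy₀ y₁ hy₁ y hy α β hα hβ hαβ hmix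
  rw [h hy, sub_le_iff_le_add]
  refine csSup_le (hXne.closure.image _) ?_
  rintro _ ⟨x, hx, rfl⟩
  have h1 := hseg x hx y₀ hy₀ y₁ hy₁ y hy α β hα hβ hαβ hmix
  have h2 := mul_le_mul_of_nonneg_left (sub_le_bTransform hYbdd hb ha hx hy₀) hα
  have h3 := mul_le_mul_of_nonneg_left (sub_le_bTransform hYbdd hb ha hx hy₁) hβ
  have h4 : bTransform b Y a x = α * bTransform b Y a x + β * bTransform b Y a x := by
    rw [← add_mul, hαβ, one_mul]
  simp only
  linarith

open Filter Topology in
/-- The supremum defining a `b*`-convex function is attained. -/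
theorem IsBStarConvex.exists_forall_le (hXbdd : Bornology.IsBounded X) (hXne : X.Nonempty)
    (hYbdd : Bornology.IsBounded Y)
    (hb : ContinuousOn (fun p : Eucl n × Eucl n => b p.1 p.2) (closure (X ×ˢ Y)))
    (ha : ContinuousOn a (closure Y)) (h : IsBStarConvex b X Y a) {y : Eucl n}
    (hy : y ∈ closure Y) :
    ∃ x ∈ closure X, ∀ y' ∈ closure Y, a y - b x y ≤ a y' - b x y' := by
  have hbdd : BddAbove ((fun x => b x y - bTransform b Y a x) '' closure X) := by
    refine ⟨a y, ?_⟩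
    rintro _ ⟨x, hx, rfl⟩
    have := sub_le_bTransform hYbdd hb ha hx hy
    simp only
    linarith
  obtain ⟨u, -, hut, hu⟩ := exists_seq_tendsto_sSup (hXne.closure.image _) hbdd
  choose xs hxs hxu using hu
  obtain ⟨x, hx, φ, hφ, hxt⟩ := hXbdd.isCompact_closure.tendsto_subseq hxs
  refine ⟨x, hx, fun y' hy' => ?_⟩
  have hut' : Tendsto (fun k => u (φ k)) atTop (𝓝 (a y)) := by
    rw [h hy]
    exact hut.comp hφ.tendsto_atTop
  have hev : ∀ᶠ k in atTop, (xs ∘ φ) k ∈ closure X := Eventually.of_forall fun k => hxs _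
  have hbt : ∀ y'' ∈ closure Y, Tendsto (fun k => b ((xs ∘ φ) k) y'') atTop (𝓝 (b x y'')) :=
    fun y'' hy'' => tendsto_of_continuousOn_closure_prod hb hxt tendsto_const_nhds hev
      (Eventually.of_forall fun _ => hy'') hx hy''
  -- Replacing `a^b(xₖ)` by its lower bound `b(xₖ, y') - a(y')` before the limit avoids any need for
  -- continuity of `a^b`.
  have hlim : a y - b x y + b x y' ≤ a y' := by
    refine le_of_tendsto' ((hut'.sub (hbt y hy)).add (hbt y' hy')) fun k => ?_
    have h1 := sub_le_bTransform hYbdd hb ha (hxs (φ k)) hy'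
    have h2 := hxu (φ k)
    simp only [Function.comp_apply] at h2 ⊢
    linarith
  linarith

/-- If every point of `Y` minimizes some `a - b(x, ·)`, then `a` is `b*`-convex. -/
theorem isBStarConvex_of_forall_exists (hXbdd : Bornology.IsBounded X)
    (hYbdd : Bornology.IsBounded Y)
    (hb : ContinuousOn (fun p : Eucl n × Eucl n => b p.1 p.2) (closure (X ×ˢ Y)))
    (ha : ContinuousOn a (closure Y))
    (h : ∀ y ∈ Y, ∃ x ∈ closure X, ∀ y' ∈ closure Y, a y - b x y ≤ a y' - b x y') :
    IsBStarConvex b X Y a := by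
  intro y hy
  -- Points of `Y` approximate a boundary `y`, and a limit of their associated `xs` makes `y` a
  -- minimizer. At such an `x` the transform equals `b x y - a y`, so the supremum is attained with
  -- value `a y`.
  obtain ⟨ys, hys, hyt⟩ := mem_closure_iff_seq_limit.1 hy
  choose xs hxs hxle using fun k => h (ys k) (hys k)
  obtain ⟨x, hx, φ, hφ, hxt⟩ := hXbdd.isCompact_closure.tendsto_subseq hxs
  have hyt' := hyt.comp hφ.tendsto_atTop
  have hev : ∀ᶠ k in Filter.atTop, (xs ∘ φ) k ∈ closure X := Filter.Eventually.of_forall fun k =>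
    hxs _
  have hev' : ∀ᶠ k in Filter.atTop, (ys ∘ φ) k ∈ closure Y := Filter.Eventually.of_forall fun k =>
    subset_closure (hys _)
  have hle : ∀ y' ∈ closure Y, a y - b x y ≤ a y' - b x y' := by
    intro y' hy'
    refine le_of_tendsto_of_tendsto'
      ((tendsto_of_continuousOn_closure ha hyt' hev' hy).sub
        (tendsto_of_continuousOn_closure_prod hb hxt hyt' hev hev' hx hy))
      ((tendsto_const_nhds (x := a y')).sub (tendsto_of_continuousOn_closure_prod hb hxt
        (tendsto_const_nhds (x := y')) hev (Filter.Eventually.of_forall fun _ => hy') hx hy'))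
      fun k => hxle (φ k) y' hy'
  refine (IsGreatest.csSup_eq (s := (fun x => b x y - bTransform b Y a x) '' closure X)
    ⟨⟨x, hx, ?_⟩, ?_⟩).symm
  · simp only
    rw [bTransform_eq_of_forall_le hy hle]
    ring
  · rintro _ ⟨x', hx', rfl⟩
    have := sub_le_bTransform hYbdd hb ha hx' hy
    simp only
    linarith

/-- First-order condition at an interior minimum of `a - b(x, ·)`. -/
theorem gradient_eq_gradY_of_forall_le (hY : IsOpen Y)
    (hb : ContDiffOn ℝ 4 (fun p : Eucl n × Eucl n => b p.1 p.2) (closure (X ×ˢ Y)))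
    (ha : DifferentiableOn ℝ a Y) {x y : Eucl n} (hx : x ∈ closure X) (hy : y ∈ Y)
    (h : ∀ y' ∈ closure Y, a y - b x y ≤ a y' - b x y') : gradient a y = gradY b x y := by
  have h1 : DifferentiableAt ℝ (b x) y :=
    (contDiffAt_snd_of_closure_prod hY hb hx hy).differentiableAt (by simp)
  have h2 : DifferentiableAt ℝ a y := (ha y hy).differentiableAt (hY.mem_nhds hy)
  have hmin : IsLocalMin (fun y' => a y' - b x y') y := by
    filter_upwards [hY.mem_nhds hy] with y' hy' using h y' (subset_closure hy')
  have h3 := hmin.fderiv_eq_zero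
  rw [fderiv_fun_sub h2 h1, sub_eq_zero] at h3
  change _ = gradient (b x) y
  simp only [gradient, h3]

end Transforms

/-! ### Stationary points are global minima -/

section Stationary

variable {n : ℕ} {b : Eucl n → Eucl n → ℝ} {X Y : Set (Eucl n)} {a : Eucl n → ℝ}

open Filter Topology in
/-- A function that is convex along the `b`-segments with respect to `x₀` and stationary at
`y₀ ∈ Y` is least at `y₀`. -/
theorem le_of_hasFDerivAt_zero_of_segment_convex (hX : IsOpen X) (hY : IsOpen Y)
    (hb : ContDiffOn ℝ 4 (fun p : Eucl n × Eucl n => b p.1 p.2) (closure (X ×ˢ Y)))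
    (htwist : BiTwist b X Y) (hconvex : BiConvexDomains b X Y)
    {x₀ y₀ y₁ : Eucl n} (hx₀ : x₀ ∈ X) (hy₀ : y₀ ∈ Y) (hy₁ : y₁ ∈ Y) {Φ : Eucl n → ℝ}
    (hΦ : ∀ y ∈ Y, ∀ α β : ℝ, 0 ≤ α → 0 ≤ β → α + β = 1 →
      gradX b x₀ y = α • gradX b x₀ y₀ + β • gradX b x₀ y₁ → Φ y ≤ α * Φ y₀ + β * Φ y₁)
    (hd : HasFDerivAt Φ (0 : Eucl n →L[ℝ] ℝ) y₀) : Φ y₀ ≤ Φ y₁ := by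
  obtain ⟨g, hinv, -, hopen, hsmooth⟩ := exists_inverse_gradX hX hY hb hx₀ (htwist.1 x₀ hx₀)
  have hconv : Convex ℝ (gradX b x₀ '' Y) := hconvex.1 x₀ hx₀
  set c : ℝ → Eucl n := fun s => gradX b x₀ y₀ + s • (gradX b x₀ y₁ - gradX b x₀ y₀) with hc
  have h0 : g (c 0) = y₀ := by
    simp only [hc, zero_smul, add_zero]
    exact hinv (subset_closure hy₀)
  have hcd : DifferentiableAt ℝ c 0 :=
    ((contDiff_const.add (contDiff_id.smul contDiff_const) :
      ContDiff ℝ 1 c).differentiable (by simp)) 0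
  have hgd : DifferentiableAt ℝ g (c 0) := by
    have : c 0 = gradX b x₀ y₀ := by simp [hc]
    rw [this]
    exact (hsmooth.contDiffAt (hopen.mem_nhds (mem_image_of_mem _ hy₀))).differentiableAt (by simp)
  have hgc : HasDerivAt (g ∘ c) (deriv (g ∘ c) 0) 0 := (hgd.comp 0 hcd).hasDerivAt
  have hF : HasDerivAt (fun t => Φ (g (c t))) 0 0 := by
    have hd' : HasFDerivAt Φ (0 : Eucl n →L[ℝ] ℝ) ((g ∘ c) 0) := by
      rw [Function.comp_apply, h0]; exact hd
    have := hd'.comp_hasDerivAt 0 hgc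
    rwa [zero_apply] at this
  have hslope : Tendsto (slope (fun t => Φ (g (c t))) 0) (𝓝[>] 0) (𝓝 0) :=
    hF.tendsto_slope.mono_left (nhdsWithin_mono _ fun t ht => ne_of_gt ht)
  suffices 0 ≤ Φ y₁ - Φ y₀ by linarith
  -- Segment convexity bounds every difference quotient at `0` by `Φ y₁ - Φ y₀`, while the quotients
  -- tend to the zero derivative.
  refine le_of_tendsto hslope ?_
  filter_upwards [Ioo_mem_nhdsGT (zero_lt_one' ℝ)] with t ht
  obtain ⟨y, hy, hyt⟩ := hconv.add_smul_sub_mem (mem_image_of_mem _ hy₀)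
    (mem_image_of_mem _ hy₁) ⟨ht.1.le, ht.2.le⟩
  have hgy : g (c t) = y := by
    simp only [hc]
    rw [← hyt]
    exact hinv (subset_closure hy)
  have h1 := hΦ y hy (1 - t) t (by linarith [ht.2]) ht.1.le (by ring) (by rw [hyt]; module)
  simp only [slope, h0, hgy, sub_zero, vsub_eq_sub, smul_eq_mul]
  rw [inv_mul_le_iff₀ ht.1]
  linarith

open Filter Topology in
/-- If `a` is convex along `b`-segments and `Da(y₀) = D_y b(x, y₀)` with `x` possibly on the
boundary of `X`, then `y₀` minimizes `a - b(x, ·)`. -/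
theorem forall_le_of_gradient_eq (hX : IsOpen X) (hXne : X.Nonempty) (hY : IsOpen Y)
    (hb : ContDiffOn ℝ 4 (fun p : Eucl n × Eucl n => b p.1 p.2) (closure (X ×ˢ Y)))
    (htwist : BiTwist b X Y) (hconvex : BiConvexDomains b X Y)
    (hseg : ∀ x₀ ∈ X, ∀ x ∈ X, IsConvexAlongSegments b Y x₀ (b x))
    (hac : ContinuousOn a (closure Y)) (ha : DifferentiableOn ℝ a Y)
    (haseg : ∀ x₀ ∈ X, IsConvexAlongSegments b Y x₀ a)
    {x y₀ : Eucl n} (hx : x ∈ closure X) (hy₀ : y₀ ∈ Y) (h : gradient a y₀ = gradY b x y₀) :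
    ∀ y ∈ closure Y, a y₀ - b x y₀ ≤ a y - b x y := by
  obtain ⟨g, hinv, hgc, hopen, -⟩ := exists_inverse_gradX (b := fun y' x' => b x' y') hY hX
    (contDiffOn_swap_closure_prod hb) hy₀ (htwist.2 y₀ hy₀)
  set f : Eucl n → Eucl n := gradX (fun y' x' => b x' y') y₀ with hf
  have hconv : Convex ℝ (f '' X) := hconvex.2 y₀ hy₀
  have hfc : ContinuousOn f (closure X) := (htwist.2 y₀ hy₀).1.continuousOn
  obtain ⟨xo, hxo⟩ := hXne
  -- A straight path from `D_y b(x, y₀)`, possibly on the boundary of the convex image, to an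
  -- interior point: for `0 < ε ≤ 1` it lies inside, so it pulls back to points of `X` tending to
  -- `x`.
  set c : ℝ → Eucl n := fun ε => f x + ε • (f xo - f x) with hc
  have hcmem : ∀ ε ∈ Ioc (0 : ℝ) 1, c ε ∈ f '' X := by
    intro ε hε
    have h1 : f x ∈ closure (f '' X) := hfc.image_closure (mem_image_of_mem f hx)
    have h2 : f xo ∈ interior (f '' X) := by
      rw [hopen.interior_eq]; exact mem_image_of_mem f hxo
    exact interior_subset (hconv.add_smul_sub_mem_interior' h1 h2 hε)
  have hg : ∀ ε ∈ Ioc (0 : ℝ) 1, g (c ε) ∈ X ∧ f (g (c ε)) = c ε := by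
    intro ε hε
    obtain ⟨x', hx', he⟩ := hcmem ε hε
    have : g (c ε) = x' := by rw [← he]; exact hinv (subset_closure hx')
    rw [this]
    exact ⟨hx', he⟩
  have hgt : Tendsto (fun ε => g (c ε)) (𝓝[>] 0) (𝓝 x) := by
    have h1 : Tendsto c (𝓝[>] 0) (𝓝[f '' closure X] (f x)) := by
      refine tendsto_nhdsWithin_iff.2 ⟨?_, ?_⟩
      · have : Continuous c := by fun_prop
        have h2 := this.tendsto 0
        simp only [hc, zero_smul, add_zero] at h2
        exact h2.mono_left nhdsWithin_le_nhds
      · filter_upwards [Ioc_mem_nhdsGT (zero_lt_one' ℝ)] with ε hε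
        exact image_mono subset_closure (hcmem ε hε)
    have h2 := (hgc _ (mem_image_of_mem f hx)).tendsto.comp h1
    rwa [hinv hx] at h2
  have hgt2 : Tendsto (fun ε => g (c (2 * ε))) (𝓝[>] 0) (𝓝 x) := by
    refine hgt.comp (tendsto_nhdsWithin_iff.2 ⟨?_, ?_⟩)
    · have : Continuous fun ε : ℝ => 2 * ε := by fun_prop
      have h2 := this.tendsto 0
      simp only [mul_zero] at h2
      exact h2.mono_left nhdsWithin_le_nhds
    · filter_upwards [self_mem_nhdsWithin] with ε hε
      exact mul_pos two_pos (mem_Ioi.1 hε)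
  have hsmall : ∀ᶠ ε in 𝓝[>] (0 : ℝ), ε ∈ Ioc (0 : ℝ) (1 / 2) :=
    Ioc_mem_nhdsGT (by norm_num)
  have hmem1 : ∀ ε ∈ Ioc (0 : ℝ) (1 / 2), ε ∈ Ioc (0 : ℝ) 1 := fun ε hε =>
    ⟨hε.1, by linarith [hε.2]⟩
  have hmem2 : ∀ ε ∈ Ioc (0 : ℝ) (1 / 2), 2 * ε ∈ Ioc (0 : ℝ) 1 := fun ε hε =>
    ⟨by linarith [hε.1], by linarith [hε.2]⟩
  have hY1 : ∀ y ∈ Y, a y₀ - b x y₀ ≤ a y - b x y := by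
    intro y₁ hy₁
    -- With `u`, `w` the points at `ε`, `2ε`, consider `a + b(w, ·) - 2 b(u, ·) = (a - b(u, ·)) +
    -- (b(w, ·) - b(u, ·))`. Both summands are convex along segments with respect to the interior
    -- point `u`. At `y₀` the gradient vanishes exactly, since `D_y b(u, y₀)` is the midpoint of
    -- `D_y b(x, y₀)` and `D_y b(w, y₀)`. As `ε → 0` the function tends to `a - b(x, ·)`.
    have hle : ∀ ε ∈ Ioc (0 : ℝ) (1 / 2),
        a y₀ + b (g (c (2 * ε))) y₀ - 2 * b (g (c ε)) y₀ ≤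
          a y₁ + b (g (c (2 * ε))) y₁ - 2 * b (g (c ε)) y₁ := by
      intro ε hε
      obtain ⟨hu, hfu⟩ := hg ε (hmem1 ε hε)
      obtain ⟨hw, hfw⟩ := hg (2 * ε) (hmem2 ε hε)
      set u := g (c ε)
      set w := g (c (2 * ε))
      refine le_of_hasFDerivAt_zero_of_segment_convex hX hY hb htwist hconvex hu hy₀ hy₁
        (Φ := fun y => a y + b w y - 2 * b u y) ?_ ?_
      · intro y hy α β hα hβ hαβ hmix
        have h1 := haseg u hu y₀ (subset_closure hy₀) y₁ (subset_closure hy₁) y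
          (subset_closure hy) α β hα hβ hαβ hmix
        have h2 := hseg u hu w hw y₀ (subset_closure hy₀) y₁ (subset_closure hy₁) y
          (subset_closure hy) α β hα hβ hαβ hmix
        linarith
      · have hda : HasGradientAt a (gradient a y₀) y₀ :=
          ((ha y₀ hy₀).differentiableAt (hY.mem_nhds hy₀)).hasGradientAt
        have hdb : ∀ v ∈ X, HasGradientAt (b v) (f v) y₀ := fun v hv =>
          ((contDiffAt_snd_of_closure_prod hY hb (subset_closure hv) hy₀).differentiableAt
            (by simp)).hasGradientAt
        have h1 := (hda.hasFDerivAt.add (hdb w hw).hasFDerivAt).sub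
          ((hdb u hu).hasFDerivAt.const_mul 2)
        refine h1.congr_fderiv ?_
        have h2 : gradient a y₀ = f x := h
        rw [hfu, hfw, h2, ← map_add]
        ext v
        simp only [hc, sub_apply, smul_apply,
          InnerProductSpace.toDual_apply_apply, inner_add_left, real_inner_smul_left, smul_eq_mul, zero_apply]
        ring
    have hlim : ∀ y ∈ Y, Tendsto (fun ε => a y + b (g (c (2 * ε))) y - 2 * b (g (c ε)) y)
        (𝓝[>] 0) (𝓝 (a y + b x y - 2 * b x y)) := by
      intro y hy
      have hy' := subset_closure hy
      refine (tendsto_const_nhds.add (tendsto_of_continuousOn_closure_prod hb.continuousOn hgt2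
        tendsto_const_nhds ?_ (Eventually.of_forall fun _ => hy') hx hy')).sub
          ((tendsto_of_continuousOn_closure_prod hb.continuousOn hgt
        tendsto_const_nhds ?_ (Eventually.of_forall fun _ => hy') hx hy').const_mul 2)
      · filter_upwards [hsmall] with ε hε using subset_closure (hg _ (hmem2 ε hε)).1
      · filter_upwards [hsmall] with ε hε using subset_closure (hg _ (hmem1 ε hε)).1
    have := le_of_tendsto_of_tendsto (hlim y₀ hy₀) (hlim y₁ hy₁)
      (by filter_upwards [hsmall] with ε hε using hle ε hε)
    linarith
  intro y hy
  obtain ⟨ys, hys, hyt⟩ := mem_closure_iff_seq_limit.1 hy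
  have hev : ∀ᶠ k in atTop, ys k ∈ closure Y := Eventually.of_forall fun k => subset_closure (hys k)
  exact ge_of_tendsto' ((tendsto_of_continuousOn_closure hac hyt hev hy).sub
    (tendsto_of_continuousOn_closure_prod hb.continuousOn (tendsto_const_nhds (x := x)) hyt
      (Eventually.of_forall fun _ => hx) hev hx hy)) fun k => hY1 (ys k) (hys k)

end Stationary

/-! ### Agents' choices and the principal's profit -/

section QuasilinearAgents

variable {n : ℕ} {b : Eucl n → Eucl n → ℝ} {X Y : Set (Eucl n)} {Z : Set ℝ} {a u : Eucl n → ℝ}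

theorem gradient_sub_const_eq_gradX (x y : Eucl n) (z : ℝ) :
    gradient (fun x' => b x' y - z) x = gradX b x y := by
  simp [gradX, gradient, fderiv_sub_const]

/-- Injectivity determines `y` from the gradient, and then the value determines `z`; hence the
arbitrary choice by `Classical.epsilon` is forced. -/
theorem optimalChoice_eq {x y : Eucl n} {z : ℝ} (hinj : InjOn (gradX b x) (closure Y))
    (hy : y ∈ closure Y) (hz : z ∈ closure Z) :
    optimalChoice (fun x y z => b x y - z) Y Z x (b x y - z) (gradX b x y) = (y, z) := by
  have hex : ∃ q : Eucl n × ℝ, q ∈ closure (Y ×ˢ Z) ∧ b x q.1 - q.2 = b x y - z ∧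
      gradient (fun x' => b x' q.1 - q.2) x = gradX b x y := by
    refine ⟨(y, z), ?_, rfl, gradient_sub_const_eq_gradX x y z⟩
    rw [closure_prod_eq]
    exact ⟨hy, hz⟩
  obtain ⟨h1, h2, h3⟩ := Classical.epsilon_spec hex
  change optimalChoice (fun x y z => b x y - z) Y Z x (b x y - z) (gradX b x y) ∈ _ at h1
  rw [closure_prod_eq] at h1
  rw [gradient_sub_const_eq_gradX] at h3
  have hfst := hinj h1.1 hy h3
  refine Prod.ext hfst ?_
  change b x (optimalChoice (fun x y z => b x y - z) Y Z x (b x y - z) (gradX b x y)).1 -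
    (optimalChoice (fun x y z => b x y - z) Y Z x (b x y - z) (gradX b x y)).2 = _ at h2
  rw [hfst] at h2
  linarith

/-- The principal's profit from agent `x`. -/
noncomputable def profitDensity (b : Eucl n → Eucl n → ℝ) (a : Eucl n → ℝ) (Y : Set (Eucl n))
    (Z : Set ℝ) (u : Eucl n → ℝ) (x : Eucl n) : ℝ :=
  (optimalChoice (fun x y z => b x y - z) Y Z x (u x) (gradient u x)).2 -
    a (optimalChoice (fun x y z => b x y - z) Y Z x (u x) (gradient u x)).1

theorem principalProfit_eq (μ : Measure (Eucl n)) :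
    principalProfit (fun x y z => b x y - z) (fun _ y z => z - a y) X Y Z μ u =
      ∫ x in X, profitDensity b a Y Z u x ∂μ := rfl

/-- Shows that `u x` enters the density affinely, so concavity rests only on how `b x y - a y`
depends on the gradient. -/
theorem profitDensity_eq {x y : Eucl n} (hinj : InjOn (gradX b x) (closure Y))
    (hy : y ∈ closure Y) (hz : b x y - u x ∈ closure Z) (hgrad : gradient u x = gradX b x y) :
    profitDensity b a Y Z u x = b x y - u x - a y := by
  have := optimalChoice_eq hinj hy hz
  rw [sub_sub_cancel] at this
  rw [profitDensity, hgrad, this]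

/-- The envelope theorem. -/
theorem exists_gradient_eq_gradX (hX : IsOpen X)
    (hb : ContDiffOn ℝ 4 (fun p : Eucl n × Eucl n => b p.1 p.2) (closure (X ×ˢ Y)))
    (hu : u ∈ gConvexFunctions (fun x y z => b x y - z) X Y Z) {x : Eucl n} (hx : x ∈ X)
    (hd : DifferentiableAt ℝ u x) :
    ∃ y ∈ closure Y, b x y - u x ∈ closure Z ∧ gradient u x = gradX b x y := by
  obtain ⟨y, hy, z, hz, hxz, hle⟩ := hu.2 x hx
  refine ⟨y, hy, by rwa [hxz, sub_sub_cancel], ?_⟩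
  have h1 : DifferentiableAt ℝ (fun x' => b x' y) x :=
    (contDiffAt_fst_of_closure_prod hX hb hx hy).differentiableAt (by simp)
  have hmin : IsLocalMin (fun x' => u x' - b x' y) x := by
    filter_upwards [hX.mem_nhds hx] with x' hx'
    have := hle x' hx'
    linarith
  have h3 := hmin.fderiv_eq_zero
  rw [fderiv_fun_sub hd h1, sub_eq_zero] at h3
  simp only [gradX, gradient, h3]

/-- Convexity of the ranges, applied to pairs (gradient, value): the mixed gradient is realized by
some `y`, and the price that goes with the mixed value stays admissible. -/
theorem exists_mix (hrange : HasConvexRanges (fun x y z => b x y - z) X Y Z)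
    {x y₀ y₁ : Eucl n} {u₀ u₁ : ℝ} (hx : x ∈ X) (hy₀ : y₀ ∈ closure Y) (hy₁ : y₁ ∈ closure Y)
    (hz₀ : b x y₀ - u₀ ∈ closure Z) (hz₁ : b x y₁ - u₁ ∈ closure Z) {α β : ℝ} (hα : 0 ≤ α)
    (hβ : 0 ≤ β) (hαβ : α + β = 1) :
    ∃ y ∈ closure Y, b x y - (α * u₀ + β * u₁) ∈ closure Z ∧
      gradX b x y = α • gradX b x y₀ + β • gradX b x y₁ := by
  have h := hrange x hx
  rw [closure_prod_eq] at h
  obtain ⟨⟨y, z⟩, ⟨hy, hz⟩, he⟩ := h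
    (mem_image_of_mem _ (⟨hy₀, hz₀⟩ : (y₀, b x y₀ - u₀) ∈ closure Y ×ˢ closure Z))
    (mem_image_of_mem _ (⟨hy₁, hz₁⟩ : (y₁, b x y₁ - u₁) ∈ closure Y ×ˢ closure Z)) hα hβ hαβ
  simp only [gradient_sub_const_eq_gradX, Prod.smul_mk, Prod.mk_add_mk, Prod.mk.injEq,
    sub_sub_cancel, smul_eq_mul] at he
  refine ⟨y, hy, ?_, he.1⟩
  rwa [← he.2, sub_sub_cancel]

/-- The `G`-convex functions form a convex set. -/
theorem convex_gConvexFunctions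
    (hrange : HasConvexRanges (fun x y z => b x y - z) X Y Z)
    (hseg : ∀ x₀ ∈ X, ∀ x ∈ closure X, IsConvexAlongSegments b Y x₀ (b x)) :
    Convex ℝ (gConvexFunctions (fun x y z => b x y - z) X Y Z) := by
  rintro u ⟨huc, hu⟩ v ⟨hvc, hv⟩ α β hα hβ hαβ
  refine ⟨(huc.const_smul α).add (hvc.const_smul β), fun x hx => ?_⟩
  obtain ⟨y₀, hy₀, z₀, hz₀, hux, hule⟩ := hu x hx
  obtain ⟨y₁, hy₁, z₁, hz₁, hvx, hvle⟩ := hv x hx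
  -- The mixed `y` supports `α • u + β • v` at `x`: by `hseg`, the same mixture of the two old
  -- supports lies above the new one.
  obtain ⟨y, hy, hz, hmix⟩ := exists_mix (u₀ := u x) (u₁ := v x) hrange hx hy₀ hy₁
    (by rwa [hux, sub_sub_cancel]) (by rwa [hvx, sub_sub_cancel]) hα hβ hαβ
  refine ⟨y, hy, _, hz, by simp, fun x' hx' => ?_⟩
  have h1 := hseg x hx x' (subset_closure hx') y₀ hy₀ y₁ hy₁ y hy α β hα hβ hαβ hmix
  have h2 := mul_le_mul_of_nonneg_left (hule x' hx') hα
  have h3 := mul_le_mul_of_nonneg_left (hvle x' hx') hβ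
  simp only [Pi.add_apply, Pi.smul_apply, smul_eq_mul]
  rw [hux, hvx]
  linarith

/-- Functions `b(·, y) - z` are `G`-convex. -/
theorem sub_const_mem_gConvexFunctions (hX : IsOpen X)
    (hb : ContDiffOn ℝ 4 (fun p : Eucl n × Eucl n => b p.1 p.2) (closure (X ×ˢ Y)))
    {y : Eucl n} {z : ℝ} (hy : y ∈ closure Y) (hz : z ∈ closure Z) :
    (fun x => b x y - z) ∈ gConvexFunctions (fun x y z => b x y - z) X Y Z := by
  refine ⟨?_, fun x _ => ⟨y, hy, z, hz, rfl, fun x' _ => le_rfl⟩⟩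
  intro x hx
  exact ((contDiffAt_fst_of_closure_prod hX hb hx hy).continuousAt.sub
    continuousAt_const).continuousWithinAt

/-- `G`-convex functions are bounded. -/
theorem exists_abs_le_of_mem_gConvexFunctions (hXbdd : Bornology.IsBounded X) (hXne : X.Nonempty)
    (hYbdd : Bornology.IsBounded Y)
    (hb : ContinuousOn (fun p : Eucl n × Eucl n => b p.1 p.2) (closure (X ×ˢ Y)))
    (hu : u ∈ gConvexFunctions (fun x y z => b x y - z) X Y Z) : ∃ C, ∀ x ∈ X, |u x| ≤ C := by
  obtain ⟨M, hM⟩ := (hXbdd.prod hYbdd).isCompact_closure.exists_bound_of_continuousOn hb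
  have hM' : ∀ x ∈ X, ∀ y ∈ closure Y, |b x y| ≤ M := fun x hx y hy => hM (x, y) (by
    rw [closure_prod_eq]; exact ⟨subset_closure hx, hy⟩)
  obtain ⟨xo, hxo⟩ := hXne
  have key : ∀ x ∈ X, ∀ x' ∈ X, u x ≤ u x' + 2 * M := by
    intro x hx x' hx'
    obtain ⟨y, hy, z, -, hxz, hle⟩ := hu.2 x hx
    have h1 := hle x' hx'
    have h2 := abs_le.1 (hM' x hx y hy)
    have h3 := abs_le.1 (hM' x' hx' y hy)
    simp only at h1 hxz
    linarith [h2.2, h3.1]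
  refine ⟨|u xo| + 2 * M, fun x hx => abs_le.2 ⟨?_, ?_⟩⟩
  · linarith [key xo hxo x hx, neg_abs_le (u xo)]
  · linarith [key x hx xo hxo, le_abs_self (u xo)]

open Topology in
/-- `G`-convex functions are differentiable almost everywhere. -/
theorem ae_differentiableAt_of_mem_gConvexFunctions (hX : IsOpen X)
    (hYbdd : Bornology.IsBounded Y)
    (hb : ContDiffOn ℝ 4 (fun p : Eucl n × Eucl n => b p.1 p.2) (closure (X ×ˢ Y)))
    (hu : u ∈ gConvexFunctions (fun x y z => b x y - z) X Y Z) :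
    ∀ᵐ x ∂(volume : Measure (Eucl n)), x ∈ X → DifferentiableAt ℝ u x := by
  rw [ae_iff]
  refine measure_null_of_locally_null _ fun x₀ hx₀ => ?_
  simp only [Classical.not_imp, mem_ofPred_eq] at hx₀
  obtain ⟨r, hr, hball⟩ := Metric.nhds_basis_closedBall.mem_iff.1 (hX.mem_nhds hx₀.1)
  have hcomp : IsCompact (Metric.closedBall x₀ r ×ˢ closure Y) :=
    (isCompact_closedBall x₀ r).prod hYbdd.isCompact_closure
  obtain ⟨L, hL⟩ := hcomp.exists_bound_of_continuousOn
    ((continuousOn_gradX hX (by norm_num) hb).mono (prod_mono hball subset_rfl))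
  -- The support at `x` bounds `u x - u x'` by an increment of some `b(·, y)`, uniformly in `y`.
  -- Thus `u` is locally Lipschitz and Rademacher's theorem applies.
  have hlip : LipschitzOnWith L.toNNReal u (Metric.ball x₀ r) := by
    refine LipschitzOnWith.of_le_add_mul _ fun x hx x' hx' => ?_
    have hxX := hball (Metric.ball_subset_closedBall hx)
    have hxX' := hball (Metric.ball_subset_closedBall hx')
    obtain ⟨y, hy, z, -, hxz, hle⟩ := hu.2 x hxX
    have h1 := hle x' hxX'
    have h2 : ‖b x y - b x' y‖ ≤ L.toNNReal * ‖x - x'‖ := by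
      refine (convex_ball x₀ r).norm_image_sub_le_of_norm_fderiv_le (𝕜 := ℝ)
        (f := fun x => b x y) (fun w hw => ?_) (fun w hw => ?_) hx' hx
      · exact (contDiffAt_fst_of_closure_prod hX hb
          (hball (Metric.ball_subset_closedBall hw)) hy).differentiableAt (by simp)
      · have := hL (w, y) ⟨Metric.ball_subset_closedBall hw, hy⟩
        simp only [gradX, gradient, LinearIsometryEquiv.norm_map] at this
        exact this.trans (Real.le_coe_toNNReal L)
    have h3 := (le_abs_self _).trans h2
    simp only at h1 hxz
    rw [dist_eq_norm]
    linarith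
  refine ⟨_, Filter.inter_mem self_mem_nhdsWithin
    (mem_nhdsWithin_of_mem_nhds (Metric.ball_mem_nhds x₀ hr)), ?_⟩
  have h := hlip.ae_differentiableWithinAt_of_mem (μ := volume)
  rw [ae_iff] at h
  refine measure_mono_null ?_ h
  rintro x ⟨hx, hxb⟩ hcon
  exact hx fun _ => (hcon hxb).differentiableAt (Metric.isOpen_ball.mem_nhds hxb)

/-- The profit density is integrable. -/
theorem integrable_profitDensity (hX : IsOpen X) (hXbdd : Bornology.IsBounded X)
    (hXne : X.Nonempty) (hYbdd : Bornology.IsBounded Y)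
    (hb : ContDiffOn ℝ 4 (fun p : Eucl n × Eucl n => b p.1 p.2) (closure (X ×ˢ Y)))
    (hinj : ∀ x ∈ X, InjOn (gradX b x) (closure Y)) (ha : ContinuousOn a (closure Y))
    (hu : u ∈ gConvexFunctions (fun x y z => b x y - z) X Y Z) (μ : Measure (Eucl n))
    [IsFiniteMeasure μ] (hμ : μ ≪ volume) :
    IntegrableOn (profitDensity b a Y Z u) X μ := by
  have hbc : ContinuousOn (fun p : Eucl n × Eucl n => b p.1 p.2) (X ×ˢ closure Y) := by
    refine hb.continuousOn.mono ?_
    rw [closure_prod_eq]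
    exact prod_mono subset_closure subset_rfl
  -- Measurability of the agents' choice: `(x, y) ↦ (x, D_x b(x, y))` is continuous and injective on
  -- a Borel set, hence a measurable embedding. So `b - a` becomes a Borel function `V` of `x` and
  -- the gradient.
  have hemb : MeasurableEmbedding ((X ×ˢ closure Y).domRestrict
      fun p : Eucl n × Eucl n => (p.1, gradX b p.1 p.2)) := by
    refine ContinuousOn.measurableEmbedding
      (hX.measurableSet.prod isClosed_closure.measurableSet)
      (continuousOn_fst.prodMk (continuousOn_gradX hX (by norm_num) hb)) ?_
    rintro ⟨x, y⟩ ⟨hx, hy⟩ ⟨x', y'⟩ ⟨hx', hy'⟩ h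
    simp only [Prod.mk.injEq] at h
    obtain ⟨rfl, h⟩ := h
    exact Prod.ext rfl (hinj x hx hy hy' h)
  have hcont : ContinuousOn (fun p : Eucl n × Eucl n => b p.1 p.2 - a p.2) (X ×ˢ closure Y) :=
    hbc.sub (ha.comp continuousOn_snd fun p hp => hp.2)
  obtain ⟨V, hV, hVeq⟩ := hemb.exists_measurable_extend
    (continuousOn_iff_continuous_domRestrict.1 hcont).measurable fun _ => ⟨0⟩
  have hVeq' : ∀ x ∈ X, ∀ y ∈ closure Y, V (x, gradX b x y) = b x y - a y := fun x hx y hy =>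
    congrFun hVeq ⟨(x, y), hx, hy⟩
  have hgrad : Measurable (gradient u) :=
    (LinearIsometryEquiv.continuous _).measurable.comp (measurable_fderiv ℝ u)
  have hdiff : ∀ᵐ x ∂μ.restrict X, x ∈ X ∧ DifferentiableAt ℝ u x := by
    have h1 := hμ.ae_le (ae_differentiableAt_of_mem_gConvexFunctions hX hYbdd hb hu)
    filter_upwards [ae_restrict_mem hX.measurableSet, ae_restrict_of_ae h1] with x hx h
    exact ⟨hx, h hx⟩
  have hmeas : AEStronglyMeasurable (profitDensity b a Y Z u) (μ.restrict X) := by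
    have h1 : AEStronglyMeasurable (fun x => V (x, gradient u x) - u x) (μ.restrict X) :=
      (hV.comp (measurable_id.prodMk hgrad)).aestronglyMeasurable.sub
        (hu.1.aestronglyMeasurable hX.measurableSet)
    refine h1.congr ?_
    filter_upwards [hdiff] with x hx
    obtain ⟨y, hy, hz, hg⟩ := exists_gradient_eq_gradX hX hb hu hx.1 hx.2
    rw [profitDensity_eq (hinj x hx.1) hy hz hg, hg, hVeq' x hx.1 y hy]
    ring
  obtain ⟨M, hM⟩ := (hXbdd.prod hYbdd).isCompact_closure.exists_bound_of_continuousOn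
    hb.continuousOn
  obtain ⟨N, hN⟩ := hYbdd.isCompact_closure.exists_bound_of_continuousOn ha
  obtain ⟨C, hC⟩ := exists_abs_le_of_mem_gConvexFunctions hXbdd hXne hYbdd hb.continuousOn hu
  refine Integrable.of_bound hmeas (M + C + N) ?_
  filter_upwards [hdiff] with x hx
  obtain ⟨y, hy, hz, hg⟩ := exists_gradient_eq_gradX hX hb hu hx.1 hx.2
  rw [profitDensity_eq (hinj x hx.1) hy hz hg]
  have h1 := hM (x, y) (by rw [closure_prod_eq]; exact ⟨subset_closure hx.1, hy⟩)
  have h2 := hN y hy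
  have h3 := hC x hx.1
  calc ‖b x y - u x - a y‖ ≤ ‖b x y - u x‖ + ‖a y‖ := norm_sub_le _ _
    _ ≤ ‖b x y‖ + ‖u x‖ + ‖a y‖ := by gcongr; exact norm_sub_le _ _
    _ ≤ M + C + N := add_le_add (add_le_add h1 h3) h2

/-- Concavity of the profit when `a` is convex along `b`-segments. -/
theorem profitIsConcave_of_segments (hX : IsOpen X) (hXbdd : Bornology.IsBounded X)
    (hXne : X.Nonempty) (hYbdd : Bornology.IsBounded Y)
    (hb : ContDiffOn ℝ 4 (fun p : Eucl n × Eucl n => b p.1 p.2) (closure (X ×ˢ Y)))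
    (hinj : ∀ x ∈ X, InjOn (gradX b x) (closure Y)) (ha : ContinuousOn a (closure Y))
    (hrange : HasConvexRanges (fun x y z => b x y - z) X Y Z)
    (hseg : ∀ x₀ ∈ X, ∀ x ∈ closure X, IsConvexAlongSegments b Y x₀ (b x))
    (haseg : ∀ x₀ ∈ X, IsConvexAlongSegments b Y x₀ a) :
    ProfitIsConcave (fun x y z => b x y - z) (fun _ y z => z - a y) X Y Z := by
  intro μ hprob _ hμ
  have hU := convex_gConvexFunctions hrange hseg
  refine ⟨hU, fun u hu v hv α β hα hβ hαβ => ?_⟩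
  have hw := hU hu hv hα hβ hαβ
  have hint : ∀ {w}, w ∈ gConvexFunctions (fun x y z => b x y - z) X Y Z →
      Integrable (profitDensity b a Y Z w) (μ.restrict X) := fun hw =>
    integrable_profitDensity hX hXbdd hXne hYbdd hb hinj ha hw μ hμ
  simp only [principalProfit_eq, smul_eq_mul]
  rw [← integral_const_mul, ← integral_const_mul,
    ← integral_add ((hint hu).const_mul α) ((hint hv).const_mul β)]
  refine integral_mono_ae (((hint hu).const_mul α).add ((hint hv).const_mul β)) (hint hw) ?_
  have hdu := hμ.ae_le (ae_differentiableAt_of_mem_gConvexFunctions hX hYbdd hb hu)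
  have hdv := hμ.ae_le (ae_differentiableAt_of_mem_gConvexFunctions hX hYbdd hb hv)
  filter_upwards [ae_restrict_mem hX.measurableSet, ae_restrict_of_ae hdu,
    ae_restrict_of_ae hdv] with x hx hdu hdv
  obtain ⟨y₀, hy₀, hz₀, hg₀⟩ := exists_gradient_eq_gradX hX hb hu hx (hdu hx)
  obtain ⟨y₁, hy₁, hz₁, hg₁⟩ := exists_gradient_eq_gradX hX hb hv hx (hdv hx)
  obtain ⟨y, hy, hz, hmix⟩ := exists_mix hrange hx hy₀ hy₁ hz₀ hz₁ hα hβ hαβ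
  have hg : gradient (α • u + β • v) x = gradX b x y := by
    rw [hmix, ← hg₀, ← hg₁]
    have h1 := ((hdu hx).hasFDerivAt.const_smul α).add ((hdv hx).hasFDerivAt.const_smul β)
    simp only [gradient]
    rw [h1.fderiv, map_add, map_smul, map_smul]
  have h := haseg x hx y₀ hy₀ y₁ hy₁ y hy α β hα hβ hαβ hmix
  rw [profitDensity_eq (hinj x hx) hy₀ hz₀ hg₀, profitDensity_eq (hinj x hx) hy₁ hz₁ hg₁,
    profitDensity_eq (hinj x hx) hy hz hg]
  simp only [Pi.add_apply, Pi.smul_apply, smul_eq_mul]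
  linarith

open Filter Topology in
/-- Conversely, concavity of the profit for all distributions of agents forces `a` to be convex
along `b`-segments. -/
theorem ProfitIsConcave.isConvexAlongSegments (hX : IsOpen X) (hXbdd : Bornology.IsBounded X)
    (hYbdd : Bornology.IsBounded Y) (hZne : Z.Nonempty)
    (hb : ContDiffOn ℝ 4 (fun p : Eucl n × Eucl n => b p.1 p.2) (closure (X ×ˢ Y)))
    (hinj : ∀ x ∈ X, InjOn (gradX b x) (closure Y)) (ha : ContinuousOn a (closure Y))
    (hrange : HasConvexRanges (fun x y z => b x y - z) X Y Z)
    (hprofit : ProfitIsConcave (fun x y z => b x y - z) (fun _ y z => z - a y) X Y Z)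
    {x₀ : Eucl n} (hx₀ : x₀ ∈ X) : IsConvexAlongSegments b Y x₀ a := by
  intro y₀ hy₀ y₁ hy₁ y hy α β hα hβ hαβ hmix
  obtain ⟨z, hz⟩ := hZne
  have hz' := subset_closure hz
  have hu₀ := sub_const_mem_gConvexFunctions hX hb hy₀ hz'
  have hu₁ := sub_const_mem_gConvexFunctions hX hb hy₁ hz'
  set u₀ : Eucl n → ℝ := fun x => b x y₀ - z with hu₀def
  set u₁ : Eucl n → ℝ := fun x => b x y₁ - z with hu₁def
  -- `w x` is the product chosen by agent `x` under `α u₀ + β u₁`; its value outside `X` is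
  -- immaterial.
  have hsel : ∀ x, ∃ w, x ∈ X → w ∈ closure Y ∧ b x w - (α * u₀ x + β * u₁ x) ∈ closure Z ∧
      gradX b x w = α • gradX b x y₀ + β • gradX b x y₁ := by
    intro x
    by_cases hx : x ∈ X
    · obtain ⟨w, h1, h2, h3⟩ := exists_mix (u₀ := u₀ x) (u₁ := u₁ x) hrange hx hy₀ hy₁
        (by simpa [hu₀def] using hz') (by simpa [hu₁def] using hz') hα hβ hαβ
      exact ⟨w, fun _ => ⟨h1, h2, h3⟩⟩
    · exact ⟨0, fun h => absurd h hx⟩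
  choose w hw using hsel
  have hwx₀ : w x₀ = y := hinj x₀ hx₀ (hw x₀ hx₀).1 hy ((hw x₀ hx₀).2.2.trans hmix.symm)
  have hXev : ∀ᶠ x in 𝓝 x₀, x ∈ X := hX.mem_nhds hx₀
  have hgradc := continuousOn_gradX hX (by norm_num) hb
  have hgt : ∀ {l : Filter (Eucl n)} {ys : Eucl n → Eucl n} {y'}, l ≤ 𝓝 x₀ →
      Tendsto ys l (𝓝 y') → (∀ᶠ x in l, ys x ∈ closure Y) → y' ∈ closure Y →
      Tendsto (fun x => gradX b x (ys x)) l (𝓝 (gradX b x₀ y')) := by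
    intro l ys y' hl hys hysY hy'
    have h1 : Tendsto (fun x => (x, ys x)) l (𝓝[X ×ˢ closure Y] (x₀, y')) := by
      refine tendsto_nhdsWithin_iff.2 ⟨(tendsto_id.mono_left hl).prodMk_nhds hys, ?_⟩
      filter_upwards [hl hXev, hysY] with x h1 h2 using ⟨h1, h2⟩
    exact (hgradc (x₀, y') ⟨hx₀, hy'⟩).tendsto.comp h1
  -- By compactness only cluster points need checking. Each one satisfies the mixing relation at
  -- `x₀`, so it equals `y` by injectivity.
  have hwt : Tendsto w (𝓝 x₀) (𝓝 y) := by
    refine hYbdd.isCompact_closure.tendsto_nhds_of_unique_mapClusterPt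
      (by filter_upwards [hXev] with x hx using (hw x hx).1) fun y' hy' hcl => ?_
    obtain ⟨U, hU, hUt⟩ := mapClusterPt_iff_ultrafilter.1 hcl
    refine hinj x₀ hx₀ hy' hy ?_
    have hl := hgt hU hUt (hU (by filter_upwards [hXev] with x hx using (hw x hx).1)) hy'
    have hr := ((hgt hU tendsto_const_nhds (Eventually.of_forall fun _ => hy₀) hy₀).const_smul
      α).add ((hgt hU tendsto_const_nhds (Eventually.of_forall fun _ => hy₁) hy₁).const_smul β)
    rw [hmix]
    refine tendsto_nhds_unique (hl.congr' ?_) hr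
    filter_upwards [hU hXev] with x hx using (hw x hx).2.2
  -- The profit from agent `x` at the mixture minus the mixture of the profits, with the `u` terms
  -- cancelled. Nonnegativity at `x₀` is the desired inequality.
  set D : Eucl n → ℝ := fun x => (b x (w x) - a (w x)) -
    (α * (b x y₀ - a y₀) + β * (b x y₁ - a y₁)) with hD
  have hXc : ∀ᶠ x in 𝓝 x₀, x ∈ closure X := by
    filter_upwards [hXev] with x hx using subset_closure hx
  have hx₀c := subset_closure hx₀
  have hbt := fun {ys : Eucl n → Eucl n} {y' : Eucl n} (h : Tendsto ys (𝓝 x₀) (𝓝 y')) h' h'' =>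
    tendsto_of_continuousOn_closure_prod hb.continuousOn tendsto_id h hXc h' hx₀c h''
  have hwev : ∀ᶠ x in 𝓝 x₀, w x ∈ closure Y := by
    filter_upwards [hXev] with x hx using (hw x hx).1
  have hDt : Tendsto D (𝓝 x₀) (𝓝 (D x₀)) := by
    simp only [hD, hwx₀]
    exact ((hbt hwt hwev hy).sub (tendsto_of_continuousOn_closure ha hwt hwev hy)).sub
      ((((hbt tendsto_const_nhds (Eventually.of_forall fun _ => hy₀) hy₀).sub_const _).const_mul
        _).add (((hbt tendsto_const_nhds (Eventually.of_forall fun _ => hy₁) hy₁).sub_const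
        _).const_mul _))
  suffices hD0 : 0 ≤ D x₀ by
    simp only [hD, hwx₀] at hD0
    linarith
  by_contra! hneg
  have hev : ∀ᶠ x in 𝓝 x₀, D x < D x₀ / 2 := hDt.eventually_lt_const (by linarith)
  obtain ⟨r, hr, hball⟩ := Metric.mem_nhds_iff.1 (hev.and hXev)
  have hne : volume (Metric.ball x₀ r) ≠ 0 := (Metric.measure_ball_pos _ _ hr).ne'
  have hfin : volume (Metric.ball x₀ r) ≠ ⊤ := measure_ball_lt_top.ne
  -- Agents uniform on a ball where `D < D x₀ / 2 < 0`: the integral of `D` would be negative,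
  -- against concavity.
  set μ : Measure (Eucl n) := ProbabilityTheory.cond volume (Metric.ball x₀ r) with hμdef
  have hprob : IsProbabilityMeasure μ :=
    ProbabilityTheory.cond_isProbabilityMeasure_of_finite hne hfin
  have hμ : μ ≪ volume := ProbabilityTheory.cond_absolutelyContinuous
  have hμball : ∀ᵐ x ∂μ, x ∈ Metric.ball x₀ r :=
    ProbabilityTheory.ae_cond_mem Metric.isOpen_ball.measurableSet
  have hμX : ∀ᵐ x ∂μ, x ∈ X := by filter_upwards [hμball] with x hx using (hball hx).2
  obtain ⟨hU, hcc⟩ := hprofit μ hprob hμX hμ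
  have hwU := hU hu₀ hu₁ hα hβ hαβ
  have hconc := hcc hu₀ hu₁ hα hβ hαβ
  have hint : ∀ {v}, v ∈ gConvexFunctions (fun x y z => b x y - z) X Y Z →
      Integrable (profitDensity b a Y Z v) (μ.restrict X) := fun hv =>
    integrable_profitDensity hX hXbdd ⟨x₀, hx₀⟩ hYbdd hb hinj ha hv μ hμ
  have hmixint : Integrable (fun x => α * profitDensity b a Y Z u₀ x +
      β * profitDensity b a Y Z u₁ x) (μ.restrict X) :=
    ((hint hu₀).const_mul α).add ((hint hu₁).const_mul β)
  simp only [principalProfit_eq, smul_eq_mul] at hconc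
  rw [← integral_const_mul, ← integral_const_mul,
    ← integral_add ((hint hu₀).const_mul α) ((hint hu₁).const_mul β), ← sub_nonneg,
    ← integral_sub (hint hwU) hmixint,
    Measure.restrict_eq_self_of_ae_mem hμX] at hconc
  have hint' := (hint hwU).sub hmixint
  rw [Measure.restrict_eq_self_of_ae_mem hμX] at hint'
  have hle := integral_mono_ae hint' (integrable_const (D x₀ / 2)) (by
    filter_upwards [hμball] with x hx
    obtain ⟨hDx, hxX⟩ := hball hx
    obtain ⟨h1, h2, h3⟩ := hw x hxX
    have hdf : ∀ {y'}, y' ∈ closure Y → DifferentiableAt ℝ (fun x' => b x' y' - z) x :=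
      fun hy' => ((contDiffAt_fst_of_closure_prod hX hb hxX hy').differentiableAt
        (by simp)).sub_const z
    have hg₀ : gradient u₀ x = gradX b x y₀ := gradient_sub_const_eq_gradX x y₀ z
    have hg₁ : gradient u₁ x = gradX b x y₁ := gradient_sub_const_eq_gradX x y₁ z
    have hg : gradient (α • u₀ + β • u₁) x = gradX b x (w x) := by
      rw [h3, ← hg₀, ← hg₁]
      have h1 := ((hdf hy₀).hasFDerivAt.const_smul α).add ((hdf hy₁).hasFDerivAt.const_smul β)
      simp only [gradient]
      rw [← map_smul, ← map_smul, ← map_add]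
      congr 1
      exact h1.fderiv
    simp only [Pi.sub_apply]
    rw [profitDensity_eq (hinj x hxX) hy₀ (by simpa [hu₀def] using hz') hg₀,
      profitDensity_eq (hinj x hxX) hy₁ (by simpa [hu₁def] using hz') hg₁,
      profitDensity_eq (hinj x hxX) h1 h2 hg]
    simp only [Pi.add_apply, Pi.smul_apply, smul_eq_mul]
    simp only [hD] at hDx ⊢
    linarith)
  simp only [integral_const, probReal_univ, one_smul] at hle
  have := hconc.trans hle
  linarith

end QuasilinearAgents

/-! ### The equivalence -/

theorem mainTheorem12 {n : ℕ} (X Y : Set (Eucl n)) (Z : Set ℝ)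
    (b : Eucl n → Eucl n → ℝ) (a : Eucl n → ℝ)
    (hXopen : IsOpen X) (hXbdd : Bornology.IsBounded X) (hXne : X.Nonempty)
    (hYopen : IsOpen Y) (hYbdd : Bornology.IsBounded Y)
    (hZopen : IsOpen Z) (hZint : Z.OrdConnected) (hZne : Z.Nonempty)
    (hb : ContDiffOn ℝ 4 (fun p : Eucl n × Eucl n => b p.1 p.2) (closure (X ×ˢ Y)))
    (htwist : BiTwist b X Y)
    (hconvex : BiConvexDomains b X Y)
    (hcurv : NonnegCrossCurvature b X Y)
    (hrange : HasConvexRanges (fun x y z => b x y - z) X Y Z)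
    (ha : ContDiffOn ℝ 2 a (closure Y)) :
    IsBStarConvex b X Y a ↔
      (ProfitIsConcave (fun x y z => b x y - z) (fun _ y z => z - a y) X Y Z ∧
        ∀ y ∈ Y, ∃ x ∈ closure X, gradient a y = gradY b x y) := by
  have hseg : ∀ x₀ ∈ X, ∀ x ∈ closure X, IsConvexAlongSegments b Y x₀ (b x) :=
    fun x₀ hx₀ x hx => isConvexAlongSegments_of_nonnegCrossCurvature hXopen hYopen hb htwist
      hconvex hcurv hx₀ hx
  have hinj : ∀ x ∈ X, InjOn (gradX b x) (closure Y) := fun x hx => (htwist.1 x hx).injOn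
  have hac : ContinuousOn a (closure Y) := ha.continuousOn
  have had : DifferentiableOn ℝ a Y := (ha.differentiableOn (by simp)).mono subset_closure
  constructor
  · intro h
    refine ⟨profitIsConcave_of_segments hXopen hXbdd hXne hYbdd hb hinj hac hrange hseg
      fun x₀ hx₀ => h.isConvexAlongSegments hXne hYbdd hb.continuousOn hac (hseg x₀ hx₀), ?_⟩
    intro y hy
    obtain ⟨x, hx, hle⟩ := h.exists_forall_le hXbdd hXne hYbdd hb.continuousOn hac
      (subset_closure hy)
    exact ⟨x, hx, gradient_eq_gradY_of_forall_le hYopen hb had hx hy hle⟩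
  · rintro ⟨hprofit, hgrad⟩
    refine isBStarConvex_of_forall_exists hXbdd hYbdd hb.continuousOn hac fun y hy => ?_
    obtain ⟨x, hx, he⟩ := hgrad y hy
    exact ⟨x, hx, forall_le_of_gradient_eq hXopen hXne hYopen hb htwist hconvex
      (fun x₀ hx₀ x hx => hseg x₀ hx₀ x (subset_closure hx)) hac had
      (fun x₀ hx₀ => hprofit.isConvexAlongSegments hXopen hXbdd hYbdd hZne hb hinj hac hrange hx₀)
      hx hy he⟩
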